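/- Let $d\ge 2$, let $n_1,\dots,n_d$ and $m_1,\dots,m_d$ be dimensions, let $\bm r=(r_1,\dots,r_{d-1})$ be positive integers and put $r_0=r_d=1$. For a real $d$-dimensional tensor $X$ let $X^{\langle k\rangle}$ be its $k$-th unfolding (rows indexed by the first $k$ modes, columns by the last $d-k$), and $\mathrm{rank}_{TT}(X)=(\mathrm{rank}\,X^{\langle 1\rangle},\dots,\mathrm{rank}\,X^{\langle d-1\rangle})$. Let $\mathcal M^{(n)}_{\bm r}\subset\mathbb R^{n_1\times\dots\times n_d}$ and $\mathcal M^{(m)}_{\bm r}\subset\mathbb R^{m_1\times\dots\times m_d}$ be the smooth embedded submanifolds of tensors of TT-rank $\bm r$. Write $[G_1,\dots,G_d]$ for the tensor with entries $\sum_{\alpha_1,\dots,\alpha_{d-1}}\prod_{k=1}^d G_k(\alpha_{k-1},i_k,\alpha_k)$ (where $\alpha_0=\alpha_d=1$), and $G_k^{(i)}=G_k(\cdot,i,\cdot)$ for the slices of a core. A representation $X=[U_1,\dots,U_{d-1},G_d]$ with cores of sizes $r_{k-1}\times n_k\times r_k$, $\bm r=\mathrm{rank}_{TT}(X)$, is left-orthogonal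 if $\sum_i (U_k^{(i)})^TU_k^{(i)}=I_{r_k}$ for $1\le k\le d-1$; a representation $X=[G_1,V_2,\dots,V_d]$ of the same sizes is right-orthogonal if $\sum_i V_k^{(i)}(V_k^{(i)})^T=I_{r_{k-1}}$ for $2\le k\le d$. The core coherence $\mu_C(X)$ is the maximum of the numbers $$\frac{r_{k-1}n_k}{r_k}\max_i\|U_k^{(i)}\|^2\ (1\le k\le d-1),\qquad \frac{r_kn_k}{r_{k-1}}\max_i\|V_k^{(i)}\|^2\ (2\le k\le d),$$ with spectral norms; it does not depend on the representations chosen. Let $Q_k\in\mathbb R^{n_k\times m_k}$ have orthonormal columns, $k\in[d]$, and let $\mathcal Q W=W\times_1Q_1\times_2\dots\times_dQ_d$ be the corresponding operator from $\mathbb R^{m_1\times\dots\times m_d}$ to $\mathbb R^{n_1\times\dots\times n_d}$, with adjoint $\mathcal Q^*$. Let $A=\mathcal Q B\in\mathcal M^{(n)}_{\bm r}$ satisfy $\mu_C(A)\le\mu_1$, and suppose that $$\mu(Q_k)=\frac{n_k}{m_k}\max_{i\in[n_k]}\|Q_k^Te_i\|^2\le\mu_2,\qquad k\in[d].$$ Let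 $\mathcal P$ be the orthogonal projection of $\mathbb R^{m_1\times\dots\times m_d}$, with the Frobenius inner product, onto the tangent space $T_B\mathcal M^{(m)}_{\bm r}$. Let $\Omega$ be a sequence of $|\Omega|$ multi-indices drawn independently and uniformly, with replacement, from $[n_1]\times\dots\times[n_d]$, let $\mathcal R_\Omega X=\sum_{\omega\in\Omega}X(\omega)E_\omega$, where $E_\omega$ are the canonical basis tensors (repetitions are counted), and let $\rho=|\Omega|/(n_1\cdots n_d)$. Put $$m=\max(m_1,\dots,m_d),\qquad C_2=\frac{\mu_1^{d-1}\mu_2}{n_1\cdots n_d}\sum_{k=1}^d r_{k-1}m_kr_k .$$ Then for all $0<\varepsilon<1$ and all $\beta>1$ such that $$\rho\ \ge\ \frac83\,\frac{C_2}{\varepsilon^2}\,d\beta\log m,$$ the restricted isometry property $$\big\|\mathcal P-\rho^{-1}\mathcal P\,\mathcal Q^*\mathcal R_\Omega\mathcal Q\,\mathcal P\big\|<\varepsilon$$ in the operator norm induced by the Frobenius norm holds with probability at least $1-2m^{d(1-\beta)}$. (Since $n_1\cdots n_d$ cancels, the condition reads $|\Omega|\ge\frac83\varepsilon^{-2}\mu_1^{d-1}\mu_2\big(\sum_k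 r_{k-1}m_kr_k\big)d\beta\log m$, which depends on the $m_k$ but not otherwise on the $n_k$.) -/

import Mathlib

open scoped ContDiff Topology

noncomputable section

namespace TensorTrain

/-- Multi-indices `(i_1, …, i_d)`, with modes numbered from `0` to `d - 1`. -/
abbrev Idx {d : ℕ} (n : Fin d → ℕ) : Type := (k : Fin d) → Fin (n k)

/-- Real `n_1 × … × n_d` tensors. The Euclidean norm is the Frobenius norm. -/
abbrev Tensor {d : ℕ} (n : Fin d → ℕ) : Type := EuclideanSpace ℝ (Idx n)

/-- The unfolding of `X` whose rows are indexed by the first `k` modes and whose columns are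
indexed by the remaining `d - k` modes. -/
def unfolding {d : ℕ} {n : Fin d → ℕ} (k : ℕ) (X : Tensor n) :
    Matrix ((j : {j : Fin d // (j : ℕ) < k}) → Fin (n j))
      ((j : {j : Fin d // ¬ (j : ℕ) < k}) → Fin (n j)) ℝ :=
  Matrix.of fun a b =>
    X ((Equiv.piEquivPiSubtypeProd (fun j : Fin d => (j : ℕ) < k) fun j => Fin (n j)).symm (a, b))

/-- The TT-rank `(r_0, r_1, …, r_{d-1}, r_d)`, where `r_k` is the rank of the `k`-th unfolding for
`1 ≤ k ≤ d - 1` and `r_0 = r_d = 1` by convention. -/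
def ttRank {d : ℕ} {n : Fin d → ℕ} (X : Tensor n) (k : Fin (d + 1)) : ℕ :=
  if k = 0 ∨ k = Fin.last d then 1 else (unfolding (k : ℕ) X).rank

/-- The set of `n_1 × … × n_d` tensors of TT-rank `r`. -/
def ttManifold {d : ℕ} (n : Fin d → ℕ) (r : Fin (d + 1) → ℕ) : Set (Tensor n) :=
  {X | ttRank X = r}

/-- The tangent space at `x` of a submanifold `M` of a normed space: the velocities at `x` of the
smooth curves in `M` through `x`. For an embedded submanifold these velocities already form a
linear subspace, and taking the span adds nothing. -/
def tangentSpaceAt {E : Type*} [NormedAddCommGroup E] [NormedSpace ℝ E] (M : Set E) (x : E) :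
    Submodule ℝ E :=
  Submodule.span ℝ {v | ∃ γ : ℝ → E, ContDiffAt ℝ ∞ γ 0 ∧ γ 0 = x ∧
    (∀ᶠ t in 𝓝 (0 : ℝ), γ t ∈ M) ∧ deriv γ 0 = v}

/-- A three-dimensional `r × n × s` core, given by its slices: the entry at `(a, i, b)` of the core
`G` is `G i a b`. -/
abbrev Core (r n s : ℕ) : Type := Fin n → Matrix (Fin r) (Fin s) ℝ

/-- The left unfolding of a core, a matrix of size `r n × s`. -/
def Core.left {r n s : ℕ} (G : Core r n s) : Matrix (Fin n × Fin r) (Fin s) ℝ :=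
  Matrix.of fun p b => G p.1 p.2 b

/-- The right unfolding of a core, a matrix of size `r × n s`. -/
def Core.right {r n s : ℕ} (G : Core r n s) : Matrix (Fin r) (Fin n × Fin s) ℝ :=
  Matrix.of fun a p => G p.1 a p.2

open scoped Matrix.Norms.L2Operator in
/-- Left coherence of a core: `(r n / s) max_i ‖G^(i)‖²` in the spectral norm, where the
`G^(i)` are the `r × s` subblocks of the left unfolding. -/
def Core.leftCoherence {r n s : ℕ} (G : Core r n s) : ℝ :=
  (r * n / s : ℝ) * ⨆ i, ‖G i‖ ^ 2

open scoped Matrix.Norms.L2Operator in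
/-- Right coherence of a core: `(s n / r) max_i ‖G^(i)‖²` in the spectral norm, where the
transposes of the `G^(i)` are the `r × s` subblocks of the right unfolding. -/
def Core.rightCoherence {r n s : ℕ} (G : Core r n s) : ℝ :=
  (s * n / r : ℝ) * ⨆ i, ‖(G i).transpose‖ ^ 2

/-- TT-cores of sizes `r_{k-1} × n_k × r_k`. -/
abbrev TTCores {d : ℕ} (n : Fin d → ℕ) (r : Fin (d + 1) → ℕ) : Type :=
  (k : Fin d) → Core (r k.castSucc) (n k) (r k.succ)

/-- The tensor `[G_1, …, G_d]`:
`X(i_1, …, i_d) = ∑_{α_0, …, α_d} ∏_k G_k(α_{k-1}, i_k, α_k)`. -/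
def TTCores.toTensor {d : ℕ} {n : Fin d → ℕ} {r : Fin (d + 1) → ℕ} (G : TTCores n r) :
    Tensor n :=
  WithLp.toLp 2 fun i =>
    ∑ α : ((k : Fin (d + 1)) → Fin (r k)), ∏ k : Fin d, G k (i k) (α k.castSucc) (α k.succ)

/-- All cores but the last one have a left unfolding with orthonormal columns. -/
def TTCores.IsLeftOrthogonal {d : ℕ} {n : Fin d → ℕ} {r : Fin (d + 1) → ℕ}
    (G : TTCores n r) : Prop :=
  ∀ k : Fin d, (k : ℕ) + 1 < d → (Core.left (G k)).transpose * Core.left (G k) = 1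

/-- All cores but the first one have a right unfolding with orthonormal rows. -/
def TTCores.IsRightOrthogonal {d : ℕ} {n : Fin d → ℕ} {r : Fin (d + 1) → ℕ}
    (G : TTCores n r) : Prop :=
  ∀ k : Fin d, 0 < (k : ℕ) → Core.right (G k) * (Core.right (G k)).transpose = 1

/-- The `k`-th left core coherence of `X`: the left coherence of the `k`-th core of a minimal
left-orthogonal TT-representation. A representation is minimal when the sizes of its cores are
given by the TT-rank of `X`. The value is the same for all these representations, so the supremum
is over a one-point set. -/
def leftCoreCoherence {d : ℕ} {n : Fin d → ℕ} (X : Tensor n) (k : Fin d) : ℝ :=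
  sSup {c | ∃ U : TTCores n (ttRank X),
    U.IsLeftOrthogonal ∧ U.toTensor = X ∧ c = Core.leftCoherence (U k)}

/-- The `k`-th right core coherence of `X`: the right coherence of the `k`-th core of a minimal
right-orthogonal TT-representation (which does not depend on the representation). -/
def rightCoreCoherence {d : ℕ} {n : Fin d → ℕ} (X : Tensor n) (k : Fin d) : ℝ :=
  sSup {c | ∃ V : TTCores n (ttRank X),
    V.IsRightOrthogonal ∧ V.toTensor = X ∧ c = Core.rightCoherence (V k)}

/-- Core coherence: the maximum of the left core coherences of all modes but the last one and the
right core coherences of all modes but the first one. -/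
def coreCoherence {d : ℕ} {n : Fin d → ℕ} (X : Tensor n) : ℝ :=
  max (⨆ k : {k : Fin d // (k : ℕ) + 1 < d}, leftCoreCoherence X k)
    (⨆ k : {k : Fin d // 0 < (k : ℕ)}, rightCoreCoherence X k)

/-- Coherence of a matrix with orthonormal columns: `(n / m) max_i ‖Qᵀ e_i‖²`
(the vector `Qᵀ e_i` is the `i`-th row of `Q`). -/
def coherence {n m : ℕ} (Q : Matrix (Fin n) (Fin m) ℝ) : ℝ :=
  (n / m : ℝ) * ⨆ i, ‖(WithLp.toLp 2 (Q i) : EuclideanSpace ℝ (Fin m))‖ ^ 2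

/-- The operator `W ↦ W ×₁ Q_1 ×₂ … ×_d Q_d`, that is,
`(i_1, …, i_d) ↦ ∑_{j_1, …, j_d} Q_1(i_1, j_1) ⋯ Q_d(i_d, j_d) W(j_1, …, j_d)`. -/
def modeProduct {d : ℕ} {n m : Fin d → ℕ} (Q : (k : Fin d) → Matrix (Fin (n k)) (Fin (m k)) ℝ) :
    Tensor m →L[ℝ] Tensor n :=
  (Matrix.toEuclideanLin
    (Matrix.of fun (i : Idx n) (j : Idx m) => ∏ k, Q k (i k) (j k))).toContinuousLinearMap

/-- The sampling operator `X ↦ ∑_{ω ∈ Ω} X(ω) E_ω` of a finite sequence `Ω` of multi-indices,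
possibly with repetitions. -/
def samplingOperator {d : ℕ} {n : Fin d → ℕ} {K : ℕ} (Ω : Fin K → Idx n) :
    Tensor n →L[ℝ] Tensor n :=
  ∑ l, (EuclideanSpace.proj (Ω l) : Tensor n →L[ℝ] ℝ).smulRight (EuclideanSpace.single (Ω l) 1)

/-- The law of `K` multi-indices drawn independently and uniformly (with replacement). -/
def sampleLaw {d : ℕ} (n : Fin d → ℕ) (K : ℕ) : MeasureTheory.Measure (Fin K → Idx n) :=
  MeasureTheory.Measure.pi fun _ => ProbabilityTheory.uniformOn Set.univ

/-- The density `ρ = K / (n_1 ⋯ n_d)` of a sample of size `K`. -/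
def density {d : ℕ} (n : Fin d → ℕ) (K : ℕ) : ℝ := K / ∏ k, (n k : ℝ)

/-- The constant `C₂ = μ₁^(d-1) μ₂ / (n_1 ⋯ n_d) * ∑_k r_{k-1} m_k r_k`. -/
def sideConst {d : ℕ} (n m : Fin d → ℕ) (r : Fin (d + 1) → ℕ) (μ₁ μ₂ : ℝ) : ℝ :=
  μ₁ ^ (d - 1) * μ₂ / (∏ k, (n k : ℝ)) * ∑ k : Fin d, (r k.castSucc * m k * r k.succ : ℝ)

end TensorTrain

end

open TensorTrain

/-! Let `N = n_1 ⋯ n_d` and `v_ξ = 𝒫 𝒬* E_ξ`. Since `𝒬* 𝒬 = 1`, the rank-one operators `v_ξ v_ξᵀ`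
sum to `𝒫` over all `ξ`, and the sampled operator is the sum of the `v_ω v_ωᵀ` over the sample.
Hence `N v_ω v_ωᵀ` has mean `𝒫` for uniform `ω`, and the claim is a matrix Bernstein bound, governed
by `max ‖v_ξ‖²`.

Bernstein (`card_norm_sum_ge_le`) follows the Ahlswede–Winter route. Golden–Thompson
(`trace_exp_add_le`) peels one factor at a time off the trace of the exponential, and a scalar
quadratic bound for `exp` controls each factor. The law is uniform on a finite set, so everything is
done by counting samples.

The structural part is `sq_modeProduct_apply_le`: `(𝒬 v)(ξ)² ≤ C₂ ‖v‖²` for `v` tangent at `B`,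
which is equivalent to `‖v_ξ‖² ≤ C₂`. A smooth curve of constant TT-rank has a velocity that each
unfolding maps from the kernel into the range (`dotProduct_deriv_mulVec_eq_zero`). So `u = 𝒬 v`
satisfies `(1 - P_k)(1 - R_k) u = 0`, where `P_k` and `R_k` project onto the column and row spaces
of the `k`-th unfolding of `A`. No dimension count or description of the whole tangent space is
needed. As the `P_k` are nested, `u = ∑ (P_{k-1} - P_k) u` is an orthogonal decomposition, and its
`k`-th term is fixed by `P_{k-1} R_k S_k`, with `S_k = Q_k Q_kᵀ` acting on mode `k`. These three
projections act on disjoint modes, so the diagonal entry of their product at `ξ` factors.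
Multiplying core norms along the train bounds the outer factors by `r_{k-1} μ₁^(k-1) / (n_1 ⋯
n_{k-1})` and `r_k μ₁^(d-k) / (n_{k+1} ⋯ n_d)`; the middle one is at most `μ₂ m_k / n_k`. By
Cauchy–Schwarz the sum over `k` of these products is `C₂`. -/

/-! ### Trace inequalities for powers of matrices -/

section MatrixTrace

open Matrix

variable {ι : Type*} [Fintype ι]

theorem trace_mul_le_half_add (X Y : Matrix ι ι ℝ) :
    (X * Y).trace ≤ ((X * Xᵀ).trace + (Yᵀ * Y).trace) / 2 := by
  have h : 0 ≤ ((X - Yᵀ) * (X - Yᵀ)ᵀ).trace := by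
    rw [trace]
    refine Finset.sum_nonneg fun i _ => ?_
    simp only [diag_apply, mul_apply, transpose_apply]
    exact Finset.sum_nonneg fun j _ => mul_self_nonneg _
  have h2 : (Yᵀ * Xᵀ).trace = (X * Y).trace := by
    rw [← transpose_mul, trace_transpose]
  rw [transpose_sub, transpose_transpose, sub_mul, mul_sub, mul_sub, trace_sub, trace_sub,
    trace_sub, h2] at h
  linarith

variable [DecidableEq ι]

theorem trace_mul_pow_comm (X Y : Matrix ι ι ℝ) (j : ℕ) :
    ((X * Y) ^ j).trace = ((Y * X) ^ j).trace := by
  cases j with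
  | zero => simp
  | succ j =>
    have h : (X * Y) ^ (j + 1) = X * ((Y * X) ^ j * Y) := by
      induction j with
      | zero => simp
      | succ j ih =>
        rw [pow_succ, ih, pow_succ (Y * X) j]
        simp only [mul_assoc]
    rw [h, trace_mul_comm, pow_succ, mul_assoc]

/-- The two statements feed each other. The first at `k + 1` comes from the first at `k` for `X²`,
then the second for `XᵀX` and `XXᵀ`, then `trace_mul_le_half_add`, whose two terms coincide by
cyclicity. The second at `k + 1` comes from the first at `k` for `P R`, then the second for `P²` and
`R²`. -/
theorem trace_pow_two_pow_le (k : ℕ) :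
    (∀ X : Matrix ι ι ℝ, (X ^ 2 ^ (k + 1)).trace ≤ ((X * Xᵀ) ^ 2 ^ k).trace) ∧
      ∀ P R : Matrix ι ι ℝ, Pᵀ = P → Rᵀ = R →
        ((P * R) ^ 2 ^ k).trace ≤ (P ^ 2 ^ k * R ^ 2 ^ k).trace := by
  induction k with
  | zero =>
    refine ⟨fun X => ?_, fun P R _ _ => by simp⟩
    have := trace_mul_le_half_add X X
    rw [trace_mul_comm Xᵀ X] at this
    simp only [zero_add, pow_one, pow_zero, pow_two]
    linarith
  | succ k ih =>
    obtain ⟨hA, hB⟩ := ih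
    constructor
    · intro X
      have e1 : X ^ 2 ^ (k + 1 + 1) = (X * X) ^ 2 ^ (k + 1) := by
        rw [← pow_two, ← pow_mul, pow_succ' 2 (k + 1)]
      have e2 : (((X * X) * (X * X)ᵀ) ^ 2 ^ k).trace = (((Xᵀ * X) * (X * Xᵀ)) ^ 2 ^ k).trace := by
        rw [transpose_mul, show X * X * (Xᵀ * Xᵀ) = (X * X * Xᵀ) * Xᵀ by simp only [mul_assoc],
          trace_mul_pow_comm]
        simp only [mul_assoc]
      have s1 : (Xᵀ * X)ᵀ = Xᵀ * X := by simp
      have s2 : (X * Xᵀ)ᵀ = X * Xᵀ := by simp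
      have h3 := trace_mul_le_half_add ((Xᵀ * X) ^ 2 ^ k) ((X * Xᵀ) ^ 2 ^ k)
      rw [transpose_pow, transpose_pow, s1, s2, ← pow_add, ← pow_add, ← two_mul, ← pow_succ',
        trace_mul_pow_comm Xᵀ X] at h3
      rw [e1]
      have h1 := hA (X * X)
      have h2 := hB _ _ s1 s2
      rw [e2] at h1
      linarith
    · intro P R hP hR
      have h1 := hA (P * R)
      have e2 : (((P * R) * (P * R)ᵀ) ^ 2 ^ k).trace = (((P * P) * (R * R)) ^ 2 ^ k).trace := by
        rw [transpose_mul, hP, hR, show P * R * (R * P) = (P * R * R) * P by simp only [mul_assoc],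
          trace_mul_pow_comm]
        simp only [mul_assoc]
      have h2 := hB (P * P) (R * R) (by simp [hP]) (by simp [hR])
      rw [e2] at h1
      rw [← pow_two, ← pow_two, ← pow_mul, ← pow_mul, ← pow_succ'] at h2
      exact h1.trans (by simpa [pow_two] using h2)

end MatrixTrace

/-! ### The Lie product formula -/

section LieProduct

open Filter Topology NormedSpace

theorem norm_pow_sub_pow_le {𝔸 : Type*} [NormedRing 𝔸] [NormOneClass 𝔸] (x y : 𝔸) {C : ℝ}
    (hx : ‖x‖ ≤ C) (hy : ‖y‖ ≤ C) (n : ℕ) :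
    ‖x ^ (n + 1) - y ^ (n + 1)‖ ≤ (n + 1) * C ^ n * ‖x - y‖ := by
  have hC : 0 ≤ C := (norm_nonneg x).trans hx
  induction n with
  | zero => simp
  | succ n ih =>
    have e : x ^ (n + 1 + 1) - y ^ (n + 1 + 1)
        = x * (x ^ (n + 1) - y ^ (n + 1)) + (x - y) * y ^ (n + 1) := by
      rw [pow_succ' x, pow_succ' y (n + 1)]; noncomm_ring
    rw [e]
    have hyp : ‖y ^ (n + 1)‖ ≤ C ^ (n + 1) :=
      (norm_pow_le y _).trans (pow_le_pow_left₀ (norm_nonneg y) hy _)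
    calc _ ≤ ‖x‖ * ‖x ^ (n + 1) - y ^ (n + 1)‖ + ‖x - y‖ * ‖y ^ (n + 1)‖ :=
          (norm_add_le _ _).trans (add_le_add (norm_mul_le _ _) (norm_mul_le _ _))
      _ ≤ C * ((n + 1) * C ^ n * ‖x - y‖) + ‖x - y‖ * C ^ (n + 1) := by gcongr
      _ = _ := by push_cast; ring

variable {𝔸 : Type*} [NormedRing 𝔸] [NormedAlgebra ℝ 𝔸] [NormOneClass 𝔸] [CompleteSpace 𝔸]

theorem norm_exp_le_exp_norm (x : 𝔸) : ‖exp x‖ ≤ Real.exp ‖x‖ := by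
  have h1 := exp_series_hasSum_exp' (𝕂 := ℝ) x
  have h2 := exp_series_hasSum_exp' (𝕂 := ℝ) ‖x‖
  rw [← Real.exp_eq_exp_ℝ] at h2
  refine (tsum_of_norm_bounded (f := fun n : ℕ => ((n.factorial : ℝ)⁻¹) • x ^ n) h2 fun n => ?_)
    |> fun h => by rwa [h1.tsum_eq] at h
  rw [norm_smul, smul_eq_mul, Real.norm_of_nonneg (by positivity)]
  gcongr
  exact norm_pow_le x n

/-- The Lie product formula along powers of two. -/
theorem tendsto_exp_mul_exp_pow (a b : 𝔸) :
    Tendsto (fun k : ℕ => (exp (((2 : ℝ) ^ k)⁻¹ • a) * exp (((2 : ℝ) ^ k)⁻¹ • b)) ^ 2 ^ k)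
      atTop (𝓝 (exp (a + b))) := by
  set f : ℝ → 𝔸 := fun t => exp (t • a) * exp (t • b) - exp (t • (a + b)) with hf
  -- The two exponentials agree to first order at `0`, so `2 ^ k * ‖f (2 ^ k)⁻¹‖` tends to `0`. This
  -- absorbs the `2 ^ k` terms of the telescoping bound for a difference of powers.
  have hd : HasDerivAt f 0 0 := by
    have h1 := hasDerivAt_exp_smul_const (𝕂 := ℝ) a 0
    have h2 := hasDerivAt_exp_smul_const (𝕂 := ℝ) b 0
    have h3 := hasDerivAt_exp_smul_const (𝕂 := ℝ) (a + b) 0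
    have := (h1.mul h2).sub h3
    rw [hf]
    refine this.congr_deriv ?_ |>.congr_of_eventuallyEq (Eventually.of_forall fun t => ?_)
    · simp
    · simp
  have hf0 : f 0 = 0 := by simp [hf]
  have hlim : Tendsto (fun k : ℕ => ((2 : ℝ) ^ k)⁻¹) atTop (𝓝[≠] 0) := by
    refine tendsto_nhdsWithin_iff.2 ⟨?_, Eventually.of_forall fun k => ?_⟩
    · exact tendsto_inv_atTop_zero.comp (tendsto_pow_atTop_atTop_of_one_lt one_lt_two)
    · simp
  have hs : Tendsto (fun k : ℕ => (2 : ℝ) ^ k * ‖f (((2 : ℝ) ^ k)⁻¹)‖) atTop (𝓝 0) := by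
    have := (hasDerivAt_iff_tendsto_slope.1 hd).comp hlim
    have := this.norm
    simp only [norm_zero] at this
    refine this.congr fun k => ?_
    simp [slope, hf0, norm_smul]
  set c : ℝ := ‖a‖ + ‖b‖ with hc
  have hbound : ∀ k : ℕ, ‖(exp (((2 : ℝ) ^ k)⁻¹ • a) * exp (((2 : ℝ) ^ k)⁻¹ • b)) ^ 2 ^ k
      - exp (a + b)‖ ≤ Real.exp c * ((2 : ℝ) ^ k * ‖f (((2 : ℝ) ^ k)⁻¹)‖) := by
    intro k
    set t : ℝ := ((2 : ℝ) ^ k)⁻¹ with ht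
    have ht0 : 0 ≤ t := by positivity
    obtain ⟨n, hn⟩ : ∃ n, 2 ^ k = n + 1 := ⟨2 ^ k - 1, by have := Nat.one_le_two_pow (n := k); omega⟩
    have hnr : (2 : ℝ) ^ k = n + 1 := by exact_mod_cast hn
    let _ : NormedAlgebra ℚ 𝔸 := NormedAlgebra.restrictScalars ℚ ℝ 𝔸
    have e1 : exp (a + b) = exp (t • (a + b)) ^ (n + 1) := by
      rw [← exp_nsmul, ← hn, ← Nat.cast_smul_eq_nsmul ℝ, smul_smul, ht]
      push_cast
      rw [mul_inv_cancel₀ (by positivity), one_smul]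
    have hX : ‖exp (t • a) * exp (t • b)‖ ≤ Real.exp (t * c) := by
      refine (norm_mul_le _ _).trans ?_
      rw [hc, mul_add, Real.exp_add]
      gcongr
      · exact (norm_exp_le_exp_norm _).trans (by rw [norm_smul, Real.norm_of_nonneg ht0])
      · exact (norm_exp_le_exp_norm _).trans (by rw [norm_smul, Real.norm_of_nonneg ht0])
    have hY : ‖exp (t • (a + b))‖ ≤ Real.exp (t * c) := by
      refine (norm_exp_le_exp_norm _).trans (Real.exp_le_exp.2 ?_)
      rw [norm_smul, Real.norm_of_nonneg ht0]
      gcongr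
      exact norm_add_le _ _
    rw [e1, hn]
    refine (norm_pow_sub_pow_le _ _ hX hY n).trans ?_
    have : Real.exp (t * c) ^ n ≤ Real.exp c := by
      rw [← Real.exp_nat_mul]
      refine Real.exp_le_exp.2 ?_
      have h1 : (n : ℝ) * t ≤ 1 := by
        rw [ht, hnr, mul_inv_le_iff₀ (by positivity)]; linarith
      have h2 : 0 ≤ c := by positivity
      nlinarith
    rw [← hnr]
    calc _ = Real.exp (t * c) ^ n * ((2 : ℝ) ^ k * ‖f t‖) := by rw [hf]; ring
      _ ≤ _ := by gcongr
  rw [tendsto_iff_norm_sub_tendsto_zero]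
  refine squeeze_zero (fun _ => norm_nonneg _) hbound ?_
  simpa using hs.const_mul (Real.exp c)

end LieProduct

/-! ### The Golden–Thompson inequality -/

section GoldenThompson

open Matrix Filter Topology

open scoped Matrix.Norms.L2Operator in
/-- The Golden–Thompson inequality for real symmetric matrices. -/
theorem trace_exp_add_le {ι : Type*} [Fintype ι] [DecidableEq ι] {A B : Matrix ι ι ℝ}
    (hA : Aᵀ = A) (hB : Bᵀ = B) :
    (NormedSpace.exp (A + B)).trace ≤ (NormedSpace.exp A * NormedSpace.exp B).trace := by
  -- The Lie product formula above requires `‖1‖ = 1`, which fails for matrices over an empty index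
  -- type.
  cases isEmpty_or_nonempty ι
  · simp [trace]
  have hlim := tendsto_exp_mul_exp_pow A B
  have htr : Continuous fun M : Matrix ι ι ℝ => M.trace := by fun_prop
  refine le_of_tendsto ((htr.tendsto _).comp hlim) (Eventually.of_forall fun k => ?_)
  have hsymm : ∀ {C : Matrix ι ι ℝ}, Cᵀ = C →
      (NormedSpace.exp (((2 : ℝ) ^ k)⁻¹ • C))ᵀ = NormedSpace.exp (((2 : ℝ) ^ k)⁻¹ • C) := by
    intro C hC
    rw [← exp_transpose, transpose_smul, hC]
  have hpow : ∀ C : Matrix ι ι ℝ,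
      NormedSpace.exp (((2 : ℝ) ^ k)⁻¹ • C) ^ 2 ^ k = NormedSpace.exp C := by
    intro C
    rw [← Matrix.exp_nsmul, ← Nat.cast_smul_eq_nsmul ℝ, smul_smul]
    push_cast
    rw [mul_inv_cancel₀ (by positivity), one_smul]
  refine ((trace_pow_two_pow_le k).2 _ _ (hsymm hA) (hsymm hB)).trans ?_
  rw [hpow, hpow]

end GoldenThompson

/-! ### Functional calculus for symmetric matrices -/

section Spectral

open Matrix

variable {ι : Type*} [Fintype ι] [DecidableEq ι]

theorem exists_orthogonal_diagonalization {A : Matrix ι ι ℝ} (hA : Aᵀ = A) :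
    ∃ (U : Matrix ι ι ℝ) (l : ι → ℝ), Uᵀ * U = 1 ∧ U * Uᵀ = 1 ∧ A = U * diagonal l * Uᵀ := by
  have hH : A.IsHermitian := by
    rw [IsHermitian, conjTranspose_eq_transpose_of_trivial, hA]
  refine ⟨hH.eigenvectorUnitary, hH.eigenvalues, ?_, ?_, ?_⟩
  · have := Unitary.coe_star_mul_self hH.eigenvectorUnitary
    rwa [star_eq_conjTranspose, conjTranspose_eq_transpose_of_trivial] at this
  · have := Unitary.coe_mul_star_self hH.eigenvectorUnitary
    rwa [Unitary.coe_star, star_eq_conjTranspose, conjTranspose_eq_transpose_of_trivial] at this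
  · have := hH.spectral_theorem
    rwa [Unitary.conjStarAlgAut_apply, star_eq_conjTranspose,
      conjTranspose_eq_transpose_of_trivial] at this

theorem exp_conj_diagonal {U : Matrix ι ι ℝ} (h1 : Uᵀ * U = 1) (l : ι → ℝ) :
    NormedSpace.exp (U * diagonal l * Uᵀ) = U * diagonal (fun i => Real.exp (l i)) * Uᵀ := by
  have hi : U⁻¹ = Uᵀ := inv_eq_left_inv h1
  have hu : IsUnit U := (isUnit_iff_isUnit_det U).2 (isUnit_det_of_left_inverse h1)
  rw [← hi, exp_conj _ _ hu, exp_diagonal]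
  congr 3
  ext i
  rw [Pi.coe_exp, Real.exp_eq_exp_ℝ]

theorem posSemidef_conj_diagonal_iff {U : Matrix ι ι ℝ} (h1 : Uᵀ * U = 1) (l : ι → ℝ) :
    (U * diagonal l * Uᵀ).PosSemidef ↔ ∀ i, 0 ≤ l i := by
  have hu : IsUnit U := (isUnit_iff_isUnit_det U).2 (isUnit_det_of_left_inverse h1)
  have := hu.posSemidef_star_right_conjugate_iff (x := diagonal l)
  rw [star_eq_conjTranspose, conjTranspose_eq_transpose_of_trivial] at this
  rw [this, posSemidef_diagonal_iff]

theorem trace_conj_diagonal {U : Matrix ι ι ℝ} (h1 : Uᵀ * U = 1) (l : ι → ℝ) :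
    (U * diagonal l * Uᵀ).trace = ∑ i, l i := by
  rw [trace_mul_comm, ← mul_assoc, h1, one_mul, trace_diagonal]

theorem smul_one_eq_conj_diagonal {U : Matrix ι ι ℝ} (h2 : U * Uᵀ = 1) (c : ℝ) :
    c • (1 : Matrix ι ι ℝ) = U * diagonal (fun _ => c) * Uᵀ := by
  rw [← smul_one_eq_diagonal, Matrix.mul_smul, mul_one, Matrix.smul_mul, h2]

theorem smul_one_sub_conj_diagonal {U : Matrix ι ι ℝ} (h2 : U * Uᵀ = 1) (l : ι → ℝ) (c : ℝ) :
    c • (1 : Matrix ι ι ℝ) - U * diagonal l * Uᵀ = U * diagonal (fun i => c - l i) * Uᵀ := by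
  rw [smul_one_eq_conj_diagonal h2, ← sub_mul, ← mul_sub, diagonal_sub]

theorem exp_posSemidef {A : Matrix ι ι ℝ} (hA : Aᵀ = A) : (NormedSpace.exp A).PosSemidef := by
  obtain ⟨U, l, h1, h2, rfl⟩ := exists_orthogonal_diagonalization hA
  rw [exp_conj_diagonal h1, posSemidef_conj_diagonal_iff h1]
  exact fun i => (Real.exp_pos _).le

/-- The Taylor remainder of order three is at most `2/9 |x|³ ≤ 1/6 x²`, and `1/2 + 1/6 = 2/3`. -/
theorem real_exp_le_of_abs_le {x : ℝ} (hx : |x| ≤ 3 / 4) :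
    Real.exp x ≤ 1 + x + 2 / 3 * x ^ 2 := by
  have h := Real.exp_bound (x := x) (by linarith) (n := 3) (by norm_num)
  simp only [Finset.sum_range_succ, Finset.sum_range_zero, Nat.factorial] at h
  have h2 := (abs_le.1 h).2
  have h3 : |x| ^ 3 ≤ 3 / 4 * x ^ 2 := by
    rw [pow_succ', sq_abs]
    exact mul_le_mul_of_nonneg_right hx (sq_nonneg x)
  norm_num at h2
  nlinarith

theorem exp_le_quadratic {A : Matrix ι ι ℝ} (hA : Aᵀ = A)
    (h1 : ((3 / 4 : ℝ) • (1 : Matrix ι ι ℝ) - A).PosSemidef)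
    (h2 : ((3 / 4 : ℝ) • (1 : Matrix ι ι ℝ) + A).PosSemidef) :
    ((1 : Matrix ι ι ℝ) + A + (2 / 3 : ℝ) • (A * A) - NormedSpace.exp A).PosSemidef := by
  obtain ⟨U, l, hU1, hU2, rfl⟩ := exists_orthogonal_diagonalization hA
  rw [smul_one_sub_conj_diagonal hU2, posSemidef_conj_diagonal_iff hU1] at h1
  rw [← sub_neg_eq_add, ← neg_mul, ← mul_neg, diagonal_neg, smul_one_sub_conj_diagonal hU2,
    posSemidef_conj_diagonal_iff hU1] at h2
  have e1 : (1 : Matrix ι ι ℝ) = U * diagonal (fun _ => (1 : ℝ)) * Uᵀ := by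
    simpa using smul_one_eq_conj_diagonal hU2 1
  have e2 : (U * diagonal l * Uᵀ) * (U * diagonal l * Uᵀ)
      = U * diagonal (fun i => l i * l i) * Uᵀ := by
    rw [← diagonal_mul_diagonal]
    calc _ = U * diagonal l * (Uᵀ * U) * diagonal l * Uᵀ := by simp only [mul_assoc]
      _ = _ := by rw [hU1]; simp only [mul_assoc, mul_one]
  have e3 : (1 : Matrix ι ι ℝ) + U * diagonal l * Uᵀ
      + (2 / 3 : ℝ) • ((U * diagonal l * Uᵀ) * (U * diagonal l * Uᵀ))
      - NormedSpace.exp (U * diagonal l * Uᵀ)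
      = U * diagonal (fun i => 1 + l i + 2 / 3 * (l i * l i) - Real.exp (l i)) * Uᵀ := by
    rw [e2, exp_conj_diagonal hU1, e1, ← Matrix.smul_mul, ← Matrix.mul_smul, ← diagonal_smul, ← add_mul,
      ← add_mul, ← sub_mul, ← mul_add, ← mul_add, ← mul_sub, diagonal_add, diagonal_add,
      diagonal_sub]
    rfl
  rw [e3, posSemidef_conj_diagonal_iff hU1]
  intro i
  have := real_exp_le_of_abs_le (x := l i)
    (abs_le.2 ⟨by have := h2 i; simp at this; linarith, by have := h1 i; linarith⟩)
  rw [pow_two] at this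
  linarith

/-- In an eigenbasis of `P` the trace pairs nonnegative eigenvalues with nonnegative diagonal
entries of the conjugated `Q`. -/
theorem trace_mul_nonneg_of_posSemidef {P Q : Matrix ι ι ℝ} (hP : P.PosSemidef)
    (hQ : Q.PosSemidef) : 0 ≤ (P * Q).trace := by
  have hs : Pᵀ = P := by
    rw [← conjTranspose_eq_transpose_of_trivial]; exact hP.isHermitian
  obtain ⟨U, l, h1, h2, rfl⟩ := exists_orthogonal_diagonalization hs
  rw [posSemidef_conj_diagonal_iff h1] at hP
  rw [mul_assoc, mul_assoc, trace_mul_comm, mul_assoc, mul_assoc, ← mul_assoc Uᵀ]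
  have hQ' : (Uᵀ * Q * U).PosSemidef := by
    simpa using hQ.conjTranspose_mul_mul_same U
  simp only [trace, diag_apply, diagonal_mul]
  exact Finset.sum_nonneg fun i _ => mul_nonneg (hP i) hQ'.diag_nonneg

open scoped Matrix.Norms.L2Operator in
-- The trace dominates `exp (θ λ)` for every single eigenvalue `λ`. One hypothesis bounds the
-- spectrum from above, the other from below.
theorem norm_lt_of_trace_exp_lt {S : Matrix ι ι ℝ} (hS : Sᵀ = S) {θ t : ℝ} (hθ : 0 < θ)
    (ht : 0 < t) (h1 : (NormedSpace.exp (θ • S)).trace < Real.exp (θ * t))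
    (h2 : (NormedSpace.exp (θ • -S)).trace < Real.exp (θ * t)) : ‖S‖ < t := by
  obtain ⟨U, l, hU1, hU2, rfl⟩ := exists_orthogonal_diagonalization hS
  have key : ∀ l' : ι → ℝ,
      (NormedSpace.exp (θ • (U * diagonal l' * Uᵀ))).trace < Real.exp (θ * t) → ∀ i, l' i < t := by
    intro l' h i
    rw [← Matrix.smul_mul, ← Matrix.mul_smul, ← diagonal_smul, exp_conj_diagonal hU1, trace_conj_diagonal hU1] at h
    have h3 : Real.exp (θ * l' i) ≤ ∑ i, Real.exp (θ * l' i) :=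
      Finset.single_le_sum (f := fun i => Real.exp (θ * l' i))
        (fun j _ => (Real.exp_pos _).le) (Finset.mem_univ i)
    exact lt_of_mul_lt_mul_left (Real.exp_lt_exp.1 (h3.trans_lt h)) hθ.le
  have k1 := key l h1
  rw [← neg_mul, ← mul_neg, diagonal_neg] at h2
  have k2 := key (-l) h2
  have hnU : ∀ V : Matrix ι ι ℝ, Vᵀ * V = 1 → ‖V‖ ≤ 1 := by
    intro V hV
    have h := l2_opNorm_conjTranspose_mul_self V
    rw [conjTranspose_eq_transpose_of_trivial, hV] at h
    have h1 : ‖(1 : Matrix ι ι ℝ)‖ ≤ 1 := by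
      rw [← diagonal_one, l2_opNorm_diagonal]
      exact (pi_norm_le_iff_of_nonneg zero_le_one).2 fun i => by simp
    nlinarith [norm_nonneg V]
  have hd : ‖diagonal l‖ < t := by
    rw [l2_opNorm_diagonal, pi_norm_lt_iff ht]
    intro i
    rw [Real.norm_eq_abs, abs_lt]
    exact ⟨by have := k2 i; simp at this; linarith, k1 i⟩
  calc ‖U * diagonal l * Uᵀ‖ ≤ ‖U‖ * ‖diagonal l‖ * ‖Uᵀ‖ :=
        (norm_mul_le _ _).trans (mul_le_mul_of_nonneg_right (norm_mul_le _ _) (norm_nonneg _))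
    _ ≤ 1 * ‖diagonal l‖ * 1 := by
        gcongr
        · exact hnU U hU1
        · exact hnU Uᵀ (by simpa using hU2)
    _ < t := by simpa using hd

end Spectral

/-! ### Matrix Bernstein inequality by counting -/

section Bernstein

open Matrix

variable {ι I : Type*} [Fintype ι] [DecidableEq ι] [Fintype I]

/-- Golden–Thompson splits off the first sample; summing over it replaces its exponential by a
matrix below `c • 1`, and pairing with the positive semidefinite remaining exponential costs a
factor `c`. -/
theorem sum_trace_exp_sum_le (X : I → Matrix ι ι ℝ) (hX : ∀ ξ, (X ξ)ᵀ = X ξ) {c : ℝ}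
    (hc : (c • (1 : Matrix ι ι ℝ) - ∑ ξ, NormedSpace.exp (X ξ)).PosSemidef) (K : ℕ)
    (hc0 : 0 ≤ c) :
    ∑ Ω : Fin K → I, (NormedSpace.exp (∑ l, X (Ω l))).trace ≤ Fintype.card ι * c ^ K := by
  induction K with
  | zero => simp [NormedSpace.exp_zero]
  | succ K ih =>
    rw [← (Fin.consEquiv fun _ => I).sum_comp, Fintype.sum_prod_type_right]
    have hsym : ∀ Ω : Fin K → I, (∑ l, X (Ω l))ᵀ = ∑ l, X (Ω l) := fun Ω => by
      rw [transpose_sum]; exact Finset.sum_congr rfl fun l _ => hX _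
    calc _ ≤ ∑ Ω : Fin K → I, c * (NormedSpace.exp (∑ l, X (Ω l))).trace := by
          refine Finset.sum_le_sum fun Ω _ => ?_
          have h1 : ∀ ξ, (NormedSpace.exp (∑ l, X ((Fin.consEquiv fun _ => I) (ξ, Ω) l))).trace
              ≤ (NormedSpace.exp (∑ l, X (Ω l)) * NormedSpace.exp (X ξ)).trace := by
            intro ξ
            rw [Fin.sum_univ_succ]
            simp only [Fin.consEquiv_apply, Fin.cons_zero, Fin.cons_succ]
            rw [add_comm]
            exact trace_exp_add_le (hsym Ω) (hX ξ)
          refine (Finset.sum_le_sum fun ξ _ => h1 ξ).trans ?_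
          have h2 := trace_mul_nonneg_of_posSemidef (exp_posSemidef (hsym Ω)) hc
          rw [mul_sub, trace_sub, Matrix.mul_smul, mul_one, trace_smul, smul_eq_mul, Finset.mul_sum,
            trace_sum] at h2
          linarith
      _ = c * ∑ Ω : Fin K → I, (NormedSpace.exp (∑ l, X (Ω l))).trace := by
          rw [Finset.mul_sum]
      _ ≤ c * (Fintype.card ι * c ^ K) := mul_le_mul_of_nonneg_left ih hc0
      _ = _ := by ring

/-- Markov's inequality for the trace of the exponential. The value of `θ` minimises `2/3 θ² R - θ
ε`, and `ε ≤ 1` keeps `θ R ≤ 3/4`, the range of the quadratic bound. The hypothesis `hv` says that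
the mean of `Y²` is at most `R`. -/
theorem card_le_trace_exp_le (Y : I → Matrix ι ι ℝ) (hY : ∀ ξ, (Y ξ)ᵀ = Y ξ) (h0 : ∑ ξ, Y ξ = 0)
    {R ε : ℝ} (hR : 0 < R) (hε0 : 0 < ε) (hε1 : ε ≤ 1)
    (hb1 : ∀ ξ, (R • (1 : Matrix ι ι ℝ) - Y ξ).PosSemidef)
    (hb2 : ∀ ξ, (R • (1 : Matrix ι ι ℝ) + Y ξ).PosSemidef)
    (hv : ((Fintype.card I * R) • (1 : Matrix ι ι ℝ) - ∑ ξ, Y ξ * Y ξ).PosSemidef)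
    (K : ℕ) (θ : ℝ) (hθ : θ = 3 * ε / (4 * R)) :
    (({Ω : Fin K → I | Real.exp (θ * (K * ε)) ≤
        (NormedSpace.exp (θ • ∑ l, Y (Ω l))).trace} : Finset _).card : ℝ)
      ≤ Fintype.card ι * (Fintype.card I : ℝ) ^ K * Real.exp (-(3 * K * ε ^ 2 / (8 * R))) := by
  have hθ0 : 0 < θ := by rw [hθ]; positivity
  have hθR : θ * R ≤ 3 / 4 := by
    rw [hθ]; field_simp; linarith
  have hbound : ∀ ξ, ((1 : Matrix ι ι ℝ) + θ • Y ξ + (2 / 3 : ℝ) • ((θ • Y ξ) * (θ • Y ξ))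
      - NormedSpace.exp (θ • Y ξ)).PosSemidef := by
    intro ξ
    have haux : ∀ Z : Matrix ι ι ℝ, (R • (1 : Matrix ι ι ℝ) + Z).PosSemidef →
        ((3 / 4 : ℝ) • (1 : Matrix ι ι ℝ) + θ • Z).PosSemidef := by
      intro Z hZ
      have e : (3 / 4 : ℝ) • (1 : Matrix ι ι ℝ) + θ • Z
          = θ • (R • (1 : Matrix ι ι ℝ) + Z) + (3 / 4 - θ * R) • (1 : Matrix ι ι ℝ) := by
        module
      rw [e]
      exact (hZ.smul hθ0.le).add (PosSemidef.one.smul (by linarith))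
    refine exp_le_quadratic (by rw [transpose_smul, hY]) ?_ (haux _ (hb2 ξ))
    have := haux (-Y ξ) (by simpa [sub_eq_add_neg] using hb1 ξ)
    simpa [sub_eq_add_neg] using this
  set N : ℝ := (Fintype.card I : ℝ) with hN
  have hc : ((N * Real.exp (2 / 3 * θ ^ 2 * R)) • (1 : Matrix ι ι ℝ)
      - ∑ ξ, NormedSpace.exp (θ • Y ξ)).PosSemidef := by
    -- Three positive semidefinite terms: the slack in the quadratic bound, the slack in the
    -- variance, and the slack in `1 + x ≤ exp x`. The linear terms cancel by `h0`.
    have e : (N * Real.exp (2 / 3 * θ ^ 2 * R)) • (1 : Matrix ι ι ℝ)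
        - ∑ ξ, NormedSpace.exp (θ • Y ξ)
        = ∑ ξ, ((1 : Matrix ι ι ℝ) + θ • Y ξ + (2 / 3 : ℝ) • ((θ • Y ξ) * (θ • Y ξ))
          - NormedSpace.exp (θ • Y ξ))
        + (2 / 3 * θ ^ 2) • ((N * R) • (1 : Matrix ι ι ℝ) - ∑ ξ, Y ξ * Y ξ)
        + (N * (Real.exp (2 / 3 * θ ^ 2 * R) - (1 + 2 / 3 * θ ^ 2 * R))) •
          (1 : Matrix ι ι ℝ) := by
      have e2 : ∀ ξ, (2 / 3 : ℝ) • ((θ • Y ξ) * (θ • Y ξ)) = (2 / 3 * θ ^ 2) • (Y ξ * Y ξ) := by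
        intro ξ
        rw [smul_mul_smul_comm, smul_smul]
        ring_nf
      simp only [e2, Finset.sum_sub_distrib, Finset.sum_add_distrib, ← Finset.smul_sum, h0,
        Finset.sum_const, Finset.card_univ, ← Nat.cast_smul_eq_nsmul ℝ, ← hN]
      module
    rw [e]
    refine ((posSemidef_sum _ fun ξ _ => hbound ξ).add (hv.smul (by positivity))).add
      (PosSemidef.one.smul (mul_nonneg (by positivity) ?_))
    have := Real.add_one_le_exp (2 / 3 * θ ^ 2 * R)
    linarith
  have hmain := sum_trace_exp_sum_le (fun ξ => θ • Y ξ)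
    (fun ξ => by rw [transpose_smul, hY]) hc K (by positivity)
  have hsym : ∀ Ω : Fin K → I, (θ • ∑ l, Y (Ω l))ᵀ = θ • ∑ l, Y (Ω l) := fun Ω => by
    rw [transpose_smul, transpose_sum]; congr 1; exact Finset.sum_congr rfl fun l _ => hY _
  simp only [← Finset.smul_sum] at hmain
  classical
  have hmk : (({Ω : Fin K → I | Real.exp (θ * (K * ε)) ≤
        (NormedSpace.exp (θ • ∑ l, Y (Ω l))).trace} : Finset _).card : ℝ)
        * Real.exp (θ * (K * ε))
      ≤ ∑ Ω : Fin K → I, (NormedSpace.exp (θ • ∑ l, Y (Ω l))).trace := by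
    rw [← nsmul_eq_mul]
    refine (Finset.card_nsmul_le_sum _ _ _ fun Ω hΩ => (Finset.mem_filter.1 hΩ).2).trans ?_
    exact Finset.sum_le_sum_of_subset_of_nonneg (Finset.subset_univ _)
      fun Ω _ _ => (exp_posSemidef (hsym Ω)).trace_nonneg
  have h3 := hmk.trans hmain
  rw [← le_div_iff₀ (Real.exp_pos _)] at h3
  refine h3.trans (le_of_eq ?_)
  -- At the chosen `θ` the exponent `K (2/3 θ² R - θ ε)` equals `-3 K ε² / (8 R)`.
  rw [mul_pow, ← Real.exp_nat_mul, ← mul_assoc, mul_div_assoc, ← Real.exp_sub]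
  congr 2
  rw [hθ]
  field_simp
  ring

open scoped Matrix.Norms.L2Operator in
-- Union of the one-sided tails of `Y` and `-Y`, whence the factor `2`.
theorem card_norm_sum_ge_le (Y : I → Matrix ι ι ℝ) (hY : ∀ ξ, (Y ξ)ᵀ = Y ξ) (h0 : ∑ ξ, Y ξ = 0)
    {R ε : ℝ} (hR : 0 < R) (hε0 : 0 < ε) (hε1 : ε ≤ 1)
    (hb1 : ∀ ξ, (R • (1 : Matrix ι ι ℝ) - Y ξ).PosSemidef)
    (hb2 : ∀ ξ, (R • (1 : Matrix ι ι ℝ) + Y ξ).PosSemidef)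
    (hv : ((Fintype.card I * R) • (1 : Matrix ι ι ℝ) - ∑ ξ, Y ξ * Y ξ).PosSemidef)
    {K : ℕ} (hK : 0 < K) :
    (({Ω : Fin K → I | K * ε ≤ ‖∑ l, Y (Ω l)‖} : Finset _).card : ℝ)
      ≤ 2 * Fintype.card ι * (Fintype.card I : ℝ) ^ K *
        Real.exp (-(3 * K * ε ^ 2 / (8 * R))) := by
  classical
  have c1 := card_le_trace_exp_le Y hY h0 hR hε0 hε1 hb1 hb2 hv K _ rfl
  have c2 := card_le_trace_exp_le (fun ξ => -Y ξ) (fun ξ => by rw [transpose_neg, hY])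
    (by simp [h0]) hR hε0 hε1 (by simpa using hb2) (by simpa [← sub_eq_add_neg] using hb1)
    (by simpa using hv) K _ rfl
  have hθ0 : 0 < 3 * ε / (4 * R) := by positivity
  have hsub : ({Ω : Fin K → I | K * ε ≤ ‖∑ l, Y (Ω l)‖} : Finset _) ⊆
      ({Ω : Fin K → I | Real.exp (3 * ε / (4 * R) * (K * ε)) ≤
        (NormedSpace.exp ((3 * ε / (4 * R)) • ∑ l, Y (Ω l))).trace} : Finset _) ∪
      ({Ω : Fin K → I | Real.exp (3 * ε / (4 * R) * (K * ε)) ≤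
        (NormedSpace.exp ((3 * ε / (4 * R)) • ∑ l, -Y (Ω l))).trace} : Finset _) := by
    intro Ω hΩ
    simp only [Finset.mem_union, Finset.mem_filter, Finset.mem_univ, true_and] at hΩ ⊢
    by_contra! hcon
    refine absurd (norm_lt_of_trace_exp_lt ?_ hθ0 (by positivity) hcon.1 ?_) (not_lt.2 hΩ)
    · rw [transpose_sum]; exact Finset.sum_congr rfl fun l _ => hY _
    · rw [← Finset.sum_neg_distrib]; exact hcon.2
  have h3 := (Finset.card_le_card hsub).trans (Finset.card_union_le _ _)
  have h4 : (({Ω : Fin K → I | K * ε ≤ ‖∑ l, Y (Ω l)‖} : Finset _).card : ℝ) ≤ _ :=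
    (Nat.cast_le (α := ℝ)).2 h3
  push_cast at h4
  linarith

end Bernstein

/-! ### Operators acting on a subset of the modes -/

namespace TensorTrain

open Matrix

section Kernels

variable {d : ℕ} {n : Fin d → ℕ}

/-- The restriction of a multi-index to the modes satisfying `p`. -/
def restr (p : Fin d → Prop) (h : Idx n) : (j : {j // p j}) → Fin (n j) := fun j => h j

/-- The multi-index that agrees with `a` on the modes satisfying `p` and with `h` elsewhere. -/
def glue (p : Fin d → Prop) [DecidablePred p] (a : (j : {j // p j}) → Fin (n j)) (h : Idx n) :
    Idx n :=
  fun l => if hl : p l then a ⟨l, hl⟩ else h l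

/-- The matrix with entries `κ i j` for the pairs `(i, j)` that agree off the modes
satisfying `p`. -/
def kern (p : Fin d → Prop) [DecidablePred p] (κ : Idx n → Idx n → ℝ) :
    Matrix (Idx n) (Idx n) ℝ :=
  of fun i j => if ∀ l, ¬ p l → i l = j l then κ i j else 0

/-- The matrix of the operator acting as `L` on the modes satisfying `p` and trivially on the
others. -/
def lift (p : Fin d → Prop) [DecidablePred p]
    (L : Matrix ((j : {j // p j}) → Fin (n j)) ((j : {j // p j}) → Fin (n j)) ℝ) :
    Matrix (Idx n) (Idx n) ℝ :=
  kern p fun i j => L (restr p i) (restr p j)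

variable {p q : Fin d → Prop} [DecidablePred p] [DecidablePred q]

omit [DecidablePred p] in
theorem restr_eq_restr {h h' : Idx n} : restr p h = restr p h' ↔ ∀ l, p l → h l = h' l :=
  ⟨fun e l hl => congrFun e ⟨l, hl⟩, fun e => funext fun j => e j j.2⟩

theorem restr_glue (a : (j : {j // p j}) → Fin (n j)) (h : Idx n) : restr p (glue p a h) = a := by
  funext j
  simp [restr, glue, j.2]

theorem glue_restr_apply (h h' : Idx n) (l : Fin d) :
    glue p (restr p h) h' l = if p l then h l else h' l := by
  simp [glue, restr]

theorem glue_apply_of_not {a : (j : {j // p j}) → Fin (n j)} {h : Idx n} {l : Fin d}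
    (hl : ¬ p l) : glue p a h l = h l := by
  simp [glue, hl]

theorem glue_apply_of_pos {a : (j : {j // p j}) → Fin (n j)} {h : Idx n} {l : Fin d}
    (hl : p l) : glue p a h l = a ⟨l, hl⟩ := by
  simp [glue, hl]

/-- Only one intermediate index contributes: the one equal to `j` on the modes `p` and to `i`
elsewhere. The hypotheses on `κ` and `ν` allow it to be replaced by `j`, respectively `i`. -/
theorem kern_mul_kern (hpq : ∀ l, p l → ¬ q l) {κ ν : Idx n → Idx n → ℝ}
    (hκ : ∀ i h j, (∀ l, p l → h l = j l) → κ i h = κ i j)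
    (hν : ∀ h i j, (∀ l, q l → h l = i l) → ν h j = ν i j) :
    kern p κ * kern q ν = kern (fun l => p l ∨ q l) fun i j => κ i j * ν i j := by
  ext i j
  rw [mul_apply]
  simp only [kern, of_apply, not_or]
  rw [Finset.sum_eq_single fun l => if p l then j l else i l]
  · have e1 : ∀ l, ¬ p l → i l = (if p l then j l else i l) := fun l hl => by simp [hl]
    rw [if_pos e1, hκ i _ j (fun l hl => by simp [hl]),
      hν _ i j (fun l hl => by simp [show ¬ p l from fun hp => hpq l hp hl])]
    by_cases hag : ∀ l, ¬ p l ∧ ¬ q l → i l = j l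
    · rw [if_pos hag, if_pos]
      intro l hl
      by_cases hp : p l
      · simp [hp]
      · simpa [hp] using hag l ⟨hp, hl⟩
    · rw [if_neg hag, if_neg, mul_zero]
      intro hc
      refine hag fun l hl => ?_
      simpa [hl.1] using hc l hl.2
  · intro h _ hne
    by_contra hc
    have h1 : ∀ l, ¬ p l → i l = h l := by
      by_contra h1; exact hc (by rw [if_neg h1, zero_mul])
    have h2 : ∀ l, ¬ q l → h l = j l := by
      by_contra h2; exact hc (by rw [if_neg h2, mul_zero])
    refine hne (funext fun l => ?_)
    by_cases hp : p l
    · simp [hp, h2 l (hpq l hp)]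
    · simp [hp, h1 l hp]
  · simp

theorem lift_commute (hpq : ∀ l, p l → ¬ q l)
    (L : Matrix ((j : {j // p j}) → Fin (n j)) ((j : {j // p j}) → Fin (n j)) ℝ)
    (M : Matrix ((j : {j // q j}) → Fin (n j)) ((j : {j // q j}) → Fin (n j)) ℝ) :
    lift p L * lift q M = lift q M * lift p L := by
  rw [lift, lift, kern_mul_kern hpq (fun i h j e => by rw [restr_eq_restr.2 e])
      (fun h i j e => by rw [restr_eq_restr.2 e]),
    kern_mul_kern (fun l hq hp => hpq l hp hq) (fun i h j e => by rw [restr_eq_restr.2 e])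
      (fun h i j e => by rw [restr_eq_restr.2 e])]
  ext i j
  simp only [kern, of_apply, mul_comm, or_comm]

/-- The product is a Kronecker product over disjoint modes. This is what separates the left, right
and middle factors in the pointwise bound. -/
theorem lift_mul_lift_mul_lift_diag {s : Fin d → Prop} [DecidablePred s]
    (hpq : ∀ l, p l → ¬ q l) (hps : ∀ l, p l → ¬ s l) (hqs : ∀ l, q l → ¬ s l)
    (L : Matrix ((j : {j // p j}) → Fin (n j)) ((j : {j // p j}) → Fin (n j)) ℝ)
    (M : Matrix ((j : {j // q j}) → Fin (n j)) ((j : {j // q j}) → Fin (n j)) ℝ)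
    (S : Matrix ((j : {j // s j}) → Fin (n j)) ((j : {j // s j}) → Fin (n j)) ℝ) (ξ : Idx n) :
    (lift p L * lift q M * lift s S) ξ ξ
      = L (restr p ξ) (restr p ξ) * M (restr q ξ) (restr q ξ) * S (restr s ξ) (restr s ξ) := by
  rw [lift, lift, lift, kern_mul_kern hpq (fun i h j e => by rw [restr_eq_restr.2 e])
      (fun h i j e => by rw [restr_eq_restr.2 e]), kern_mul_kern]
  · simp [kern]
  · rintro l (hl | hl)
    exacts [hps l hl, hqs l hl]
  · intro i h j e
    rw [restr_eq_restr.2 fun l hl => e l (Or.inl hl), restr_eq_restr.2 fun l hl => e l (Or.inr hl)]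
  · intro h i j e
    rw [restr_eq_restr.2 e]

theorem lift_mulVec (L : Matrix ((j : {j // p j}) → Fin (n j)) ((j : {j // p j}) → Fin (n j)) ℝ)
    (f : Idx n → ℝ) (h : Idx n) :
    (lift p L *ᵥ f) h = ∑ a, L (restr p h) a * f (glue p a h) := by
  simp only [mulVec, dotProduct, lift, kern, of_apply, ite_mul, zero_mul]
  rw [← Finset.sum_filter]
  refine Finset.sum_bij' (fun i _ => restr p i) (fun a _ => glue p a h) (by simp) ?_ ?_ ?_ ?_
  · intro a _
    simp only [Finset.mem_filter, Finset.mem_univ, true_and]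
    intro l hl
    rw [glue_apply_of_not hl]
  · intro i hi
    simp only [Finset.mem_filter, Finset.mem_univ, true_and] at hi
    funext l
    rw [glue_restr_apply]
    split_ifs with hl
    · rfl
    · exact hi l hl
  · intro a _
    exact restr_glue a h
  · intro i hi
    simp only [Finset.mem_filter, Finset.mem_univ, true_and] at hi
    congr 2
    funext l
    rw [glue_restr_apply]
    split_ifs with hl
    · rfl
    · exact (hi l hl).symm

theorem lift_mul (L M : Matrix ((j : {j // p j}) → Fin (n j)) ((j : {j // p j}) → Fin (n j)) ℝ) :
    lift p (L * M) = lift p L * lift p M := by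
  suffices key : ∀ f, lift p (L * M) *ᵥ f = (lift p L * lift p M) *ᵥ f from
    ext_of_mulVec_single fun i => key _
  intro f
  funext h
  rw [← mulVec_mulVec]
  simp only [lift_mulVec, mul_apply, restr_glue, Finset.sum_mul, Finset.mul_sum]
  rw [Finset.sum_comm]
  refine Finset.sum_congr rfl fun a _ => Finset.sum_congr rfl fun b _ => ?_
  rw [mul_assoc]
  congr 3
  funext l
  by_cases hl : p l
  · simp [glue, hl]
  · simp [glue, hl]

theorem lift_one : lift p (1 : Matrix ((j : {j // p j}) → Fin (n j)) _ ℝ) = 1 := by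
  suffices key : ∀ f, lift p (1 : Matrix ((j : {j // p j}) → Fin (n j)) _ ℝ) *ᵥ f = 1 *ᵥ f from
    ext_of_mulVec_single fun i => key _
  intro f
  funext h
  rw [lift_mulVec, one_mulVec]
  simp only [one_apply, ite_mul, one_mul, zero_mul, Finset.sum_ite_eq, Finset.mem_univ, if_true]
  congr 1
  funext l
  simp [glue_restr_apply]

theorem lift_sub (L M : Matrix ((j : {j // p j}) → Fin (n j)) ((j : {j // p j}) → Fin (n j)) ℝ) :
    lift p (L - M) = lift p L - lift p M := by
  ext i j
  simp only [lift, kern, of_apply, Matrix.sub_apply]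
  split_ifs <;> simp

theorem lift_transpose
    (L : Matrix ((j : {j // p j}) → Fin (n j)) ((j : {j // p j}) → Fin (n j)) ℝ) :
    (lift p L)ᵀ = lift p Lᵀ := by
  ext i j
  simp only [lift, kern, of_apply, transpose_apply]
  simp only [eq_comm]

/-- The span of the functions `h ↦ f (h on p, b off p)`. -/
def slices (p : Fin d → Prop) [DecidablePred p] (f : Idx n → ℝ) : Submodule ℝ (Idx n → ℝ) :=
  Submodule.span ℝ (Set.range fun b h => f (glue p (restr p h) b))

/-- An operator on modes inside `q` commutes with freezing the modes outside `q`, so it fixes every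
slice of a function that it fixes. Nestedness of the interface spaces rests on this. -/
theorem lift_mulVec_of_mem_slices (hpq : ∀ l, p l → q l)
    {L : Matrix ((j : {j // p j}) → Fin (n j)) ((j : {j // p j}) → Fin (n j)) ℝ}
    {f g : Idx n → ℝ} (hf : lift p L *ᵥ f = f) (hg : g ∈ slices q f) : lift p L *ᵥ g = g := by
  have hle : slices q f ≤ LinearMap.eqLocus (lift p L).mulVecLin LinearMap.id := by
    rw [slices, Submodule.span_le]
    rintro _ ⟨b, rfl⟩
    rw [SetLike.mem_coe, LinearMap.mem_eqLocus, mulVecLin_apply, LinearMap.id_apply]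
    funext h
    rw [lift_mulVec]
    have := congrFun hf (glue q (restr q h) b)
    rw [lift_mulVec] at this
    refine Eq.trans ?_ this
    refine Finset.sum_congr rfl fun a _ => ?_
    congr 1
    · congr 1
      rw [restr_eq_restr]
      intro l hl
      rw [glue_restr_apply, if_pos (hpq l hl)]
    · refine congrArg f (funext fun l => ?_)
      rw [glue_restr_apply]
      by_cases hp : p l
      · rw [glue_apply_of_pos hp, glue_apply_of_pos hp, if_pos (hpq l hp)]
      · rw [glue_apply_of_not hp, glue_apply_of_not hp, glue_restr_apply]
  simpa using LinearMap.mem_eqLocus.1 (hle hg)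

/-- An operator on the modes `p ⊆ q` that fixes every column of `W` fixes the range of `W Wᵀ`. -/
theorem lift_mul_lift_gram (hpq : ∀ l, p l → q l)
    {L : Matrix ((j : {j // p j}) → Fin (n j)) ((j : {j // p j}) → Fin (n j)) ℝ} {r : ℕ}
    {W : Matrix ((j : {j // q j}) → Fin (n j)) (Fin r) ℝ}
    (hW : ∀ β, (lift p L *ᵥ fun h => W (restr q h) β) = fun h => W (restr q h) β) :
    lift p L * lift q (W * Wᵀ) = lift q (W * Wᵀ) := by
  ext i j
  have h1 : (lift p L * lift q (W * Wᵀ)) i j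
      = (lift p L *ᵥ fun h => lift q (W * Wᵀ) h j) i := rfl
  rw [h1, lift_mulVec]
  have h2 : ∀ a, (∀ l, ¬ q l → glue p a i l = j l) ↔ (∀ l, ¬ q l → i l = j l) := fun a =>
    forall₂_congr fun l hl => by rw [glue_apply_of_not fun hp => hl (hpq l hp)]
  simp only [lift, kern, of_apply, h2]
  split_ifs with hij
  · simp only [mul_apply, transpose_apply]
    simp only [Finset.mul_sum]
    rw [Finset.sum_comm]
    refine Finset.sum_congr rfl fun β _ => ?_
    have := congrFun (hW β) i
    rw [lift_mulVec] at this
    rw [← this, Finset.sum_mul]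
    exact Finset.sum_congr rfl fun a _ => by ring
  · simp

end Kernels

end TensorTrain

/-! ### Interface matrices and orthogonal TT-representations -/

namespace TensorTrain

open Matrix

/-- An orthonormal basis of the column space of a matrix. -/
theorem exists_orthonormal_columns {a b : Type*} [Fintype a] [Fintype b] [DecidableEq a]
    [DecidableEq b] (A : Matrix a b ℝ) :
    ∃ W : Matrix a (Fin A.rank) ℝ, Wᵀ * W = 1 ∧ W * Wᵀ * A = A ∧ ∃ Z : Matrix b (Fin A.rank) ℝ, W = A * Z := by
  set C : Submodule ℝ (EuclideanSpace ℝ a) := LinearMap.range (toEuclideanLin A) with hC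
  have hfin : Module.finrank ℝ C = A.rank := by
    rw [hC, toEuclideanLin_eq_toLin_orthonormal]
    exact (rank_eq_finrank_range_toLin A _ _).symm
  set e := (stdOrthonormalBasis ℝ C).reindex (finCongr hfin) with he
  refine ⟨of fun i α => (e α : EuclideanSpace ℝ a) i, ?_, ?_, ?_⟩
  · ext α β
    have h := orthonormal_iff_ite.1 e.orthonormal α β
    rw [Submodule.coe_inner, EuclideanSpace.inner_eq_star_dotProduct] at h
    simp only [mul_apply, transpose_apply, of_apply, one_apply]
    rw [← h, dotProduct]
    exact Finset.sum_congr rfl fun i _ => by simp [mul_comm]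
  · ext i j
    have hmem : toEuclideanLin A (EuclideanSpace.single j 1) ∈ C := LinearMap.mem_range_self _ _
    have hx := e.sum_repr' ⟨_, hmem⟩
    have hx' := congrArg (fun x : C => (x : EuclideanSpace ℝ a) i) hx
    have hcol : ∀ i, (toEuclideanLin A (EuclideanSpace.single j 1)) i = A i j := by
      intro i
      simp [toLpLin_apply]
    simp only [hcol] at hx'
    refine Eq.trans ?_ hx'
    rw [Matrix.mul_assoc, mul_apply]
    simp only [Submodule.coe_sum, Submodule.coe_smul, WithLp.ofLp_sum, Finset.sum_apply,
      WithLp.ofLp_smul, Pi.smul_apply, smul_eq_mul, of_apply]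
    refine Finset.sum_congr rfl fun α _ => ?_
    rw [mul_comm]
    congr 1
    rw [Submodule.coe_inner, EuclideanSpace.inner_eq_star_dotProduct, mul_apply, dotProduct]
    refine Finset.sum_congr rfl fun i' _ => ?_
    rw [hcol, mul_comm]
    simp
  · have : ∀ α, ∃ z, toEuclideanLin A z = e α := fun α => LinearMap.mem_range.1 (e α).2
    choose z hz using this
    refine ⟨of fun j α => z α j, ?_⟩
    ext i α
    rw [of_apply, ← hz α]
    rw [mul_apply]
    simp [toLpLin_apply, mulVec, dotProduct]

section Unfolding

variable {d : ℕ} {n : Fin d → ℕ}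

theorem glue_eq_symm (p : Fin d → Prop) [DecidablePred p] (a : (j : {j // p j}) → Fin (n j))
    (h : Idx n) :
    glue p a h = (Equiv.piEquivPiSubtypeProd p fun j => Fin (n j)).symm
      (a, restr (fun j => ¬ p j) h) := by
  funext l
  simp [glue, restr, Equiv.piEquivPiSubtypeProd]

theorem glue_not_eq_symm (p : Fin d → Prop) [DecidablePred p]
    (b : (j : {j // ¬ p j}) → Fin (n j)) (h : Idx n) :
    glue (fun j => ¬ p j) b h = (Equiv.piEquivPiSubtypeProd p fun j => Fin (n j)).symm
      (restr p h, b) := by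
  funext l
  by_cases hl : p l <;> simp [glue, restr, Equiv.piEquivPiSubtypeProd, hl]

theorem unfolding_restr (k : ℕ) (X : Tensor n) (h : Idx n) :
    unfolding k X (restr _ h) (restr _ h) = X h := by
  exact congrArg X.ofLp ((Equiv.piEquivPiSubtypeProd (fun j : Fin d => (j : ℕ) < k)
    fun j => Fin (n j)).symm_apply_apply h)

theorem unfolding_lift_left (k : ℕ) (L) (X : Tensor n) :
    unfolding k (WithLp.toLp 2 (lift (fun j : Fin d => (j : ℕ) < k) L *ᵥ X.ofLp) : Tensor n)
      = L * unfolding k X := by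
  ext a b
  obtain ⟨h, hh⟩ := (Equiv.piEquivPiSubtypeProd (fun j : Fin d => (j : ℕ) < k)
    fun j => Fin (n j)).surjective (a, b)
  have ha : a = restr _ h := (congrArg Prod.fst hh).symm
  have hb : b = restr _ h := (congrArg Prod.snd hh).symm
  subst ha hb
  rw [unfolding_restr]
  change (lift _ L *ᵥ X.ofLp) h = _
  rw [lift_mulVec, mul_apply]
  refine Finset.sum_congr rfl fun a _ => ?_
  rw [glue_eq_symm]
  rfl

theorem unfolding_lift_right (k : ℕ) (R) (X : Tensor n) :
    unfolding k (WithLp.toLp 2 (lift (fun j : Fin d => ¬ (j : ℕ) < k) R *ᵥ X.ofLp) : Tensor n)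
      = unfolding k X * Rᵀ := by
  ext a b
  obtain ⟨h, hh⟩ := (Equiv.piEquivPiSubtypeProd (fun j : Fin d => (j : ℕ) < k)
    fun j => Fin (n j)).surjective (a, b)
  have ha : a = restr _ h := (congrArg Prod.fst hh).symm
  have hb : b = restr _ h := (congrArg Prod.snd hh).symm
  subst ha hb
  rw [unfolding_restr]
  change (lift _ R *ᵥ X.ofLp) h = _
  rw [lift_mulVec, mul_apply]
  refine Finset.sum_congr rfl fun b _ => ?_
  rw [glue_not_eq_symm (fun j : Fin d => (j : ℕ) < k), mul_comm]
  rfl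

theorem unfolding_injective (k : ℕ) {X Y : Tensor n} (h : unfolding k X = unfolding k Y) :
    X = Y := by
  ext i
  rw [← unfolding_restr k X, h, unfolding_restr]

/-- The columns of `W` are an orthonormal basis of the column space of the unfolding; being
combinations of its columns, they are combinations of slices of `A`. The rank is a separate variable
so that it can be `ttRank A k`, which is the rank of the unfolding only at interior `k`. -/
theorem exists_left_interface [Nonempty (Idx n)] (A : Tensor n) (k : ℕ) (r : ℕ)
    (hr : r = (unfolding k A).rank) :
    ∃ W : Matrix ((j : {j : Fin d // (j : ℕ) < k}) → Fin (n j)) (Fin r) ℝ, Wᵀ * W = 1 ∧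
      lift (fun j : Fin d => (j : ℕ) < k) (W * Wᵀ) *ᵥ A.ofLp = A.ofLp ∧
      ∀ β, (fun h => W (restr _ h) β) ∈ slices (fun j : Fin d => (j : ℕ) < k) A.ofLp := by
  subst hr
  obtain ⟨W, h1, h2, Z, h3⟩ := exists_orthonormal_columns (unfolding k A)
  refine ⟨W, h1, ?_, fun β => ?_⟩
  · have := unfolding_injective k ((unfolding_lift_left k (W * Wᵀ) A).trans h2)
    exact congrArg WithLp.ofLp this
  · have e : (fun h => W (restr _ h) β) = ∑ b, Z b β • fun h : Idx n =>
        A.ofLp (glue (fun j : Fin d => (j : ℕ) < k) (restr _ h)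
          (glue (fun j : Fin d => ¬ (j : ℕ) < k) b (Classical.arbitrary _))) := by
      funext h
      rw [h3, mul_apply, Finset.sum_apply]
      refine Finset.sum_congr rfl fun b _ => ?_
      rw [Pi.smul_apply, smul_eq_mul, mul_comm]
      congr 1
      rw [glue_eq_symm, restr_glue]
      rfl
    rw [e]
    exact Submodule.sum_mem _ fun b _ => Submodule.smul_mem _ _
      (Submodule.subset_span (Set.mem_range_self _))

theorem exists_right_interface [Nonempty (Idx n)] (A : Tensor n) (k : ℕ) (r : ℕ)
    (hr : r = (unfolding k A).rank) :
    ∃ W : Matrix ((j : {j : Fin d // ¬ (j : ℕ) < k}) → Fin (n j)) (Fin r) ℝ, Wᵀ * W = 1 ∧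
      lift (fun j : Fin d => ¬ (j : ℕ) < k) (W * Wᵀ) *ᵥ A.ofLp = A.ofLp ∧
      ∀ β, (fun h => W (restr _ h) β) ∈ slices (fun j : Fin d => ¬ (j : ℕ) < k) A.ofLp := by
  rw [← rank_transpose] at hr
  subst hr
  obtain ⟨W, h1, h2, Z, h3⟩ := exists_orthonormal_columns (unfolding k A)ᵀ
  refine ⟨W, h1, ?_, fun β => ?_⟩
  · have h2' : unfolding k A * (W * Wᵀ)ᵀ = unfolding k A := by
      have := congrArg transpose h2
      rwa [transpose_mul, transpose_transpose] at this
    have := unfolding_injective k ((unfolding_lift_right k (W * Wᵀ) A).trans h2')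
    exact congrArg WithLp.ofLp this
  · have e : (fun h => W (restr _ h) β) = ∑ b, Z b β • fun h : Idx n =>
        A.ofLp (glue (fun j : Fin d => ¬ (j : ℕ) < k) (restr _ h)
          (glue (fun j : Fin d => (j : ℕ) < k) b (Classical.arbitrary _))) := by
      funext h
      rw [h3, mul_apply, Finset.sum_apply]
      refine Finset.sum_congr rfl fun b _ => ?_
      rw [Pi.smul_apply, smul_eq_mul, mul_comm]
      congr 1
      rw [glue_not_eq_symm (fun j : Fin d => (j : ℕ) < k), restr_glue]
      rfl
    rw [e]
    exact Submodule.sum_mem _ fun b _ => Submodule.smul_mem _ _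
      (Submodule.subset_span (Set.mem_range_self _))

end Unfolding

section CoreStep

variable {d : ℕ} {n : Fin d → ℕ} {p q : Fin d → Prop} [DecidablePred p] [DecidablePred q]
  {k : Fin d}

omit [DecidablePred q] in
-- The core is `Wᵀ W'` contracted over the modes `p`, with mode `k` left free; multiplying back by
-- `W` gives the projection of `W'`, which is `W'`. With `p` abstract, the lemma serves trains built
-- from either end.
theorem exists_core_of_lift_mulVec_eq [Nonempty (Idx n)] (hk : ¬ p k)
    (hq : ∀ l, q l ↔ p l ∨ l = k)
    {r s : ℕ} (W : Matrix ((j : {j // p j}) → Fin (n j)) (Fin r) ℝ)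
    (W' : Matrix ((j : {j // q j}) → Fin (n j)) (Fin s) ℝ)
    (hW : ∀ β, (lift p (W * Wᵀ) *ᵥ fun h => W' (restr q h) β) = fun h => W' (restr q h) β) :
    ∃ G : Core r (n k) s, ∀ (h : Idx n) β,
      W' (restr q h) β = ∑ α, W (restr p h) α * G (h k) α β := by
  -- The arbitrary multi-index is immaterial: `W'` reads only the modes in `q`, which `a` and `c`
  -- determine.
  refine ⟨fun c => of fun α β => ∑ a, W a α *
    W' (restr q (glue p a (Function.update (Classical.arbitrary _) k c))) β, fun h β => ?_⟩
  have := congrFun (hW β) h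
  rw [lift_mulVec] at this
  rw [← this]
  simp only [mul_apply, transpose_apply, of_apply, Finset.mul_sum, Finset.sum_mul]
  rw [Finset.sum_comm]
  refine Finset.sum_congr rfl fun α _ => Finset.sum_congr rfl fun a _ => ?_
  rw [mul_assoc]
  congr 3
  rw [restr_eq_restr]
  intro l hl
  rcases (hq l).1 hl with hp | rfl
  · rw [glue_apply_of_pos hp, glue_apply_of_pos hp]
  · rw [glue_apply_of_not hk, glue_apply_of_not hk, Function.update_self]

theorem sum_restr_eq (hk : ¬ p k) (hq : ∀ l, q l ↔ p l ∨ l = k) (h₀ : Idx n)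
    (F : ((j : {j // q j}) → Fin (n j)) → ℝ) :
    ∑ x, F x = ∑ c : Fin (n k), ∑ a, F (restr q (glue p a (Function.update h₀ k c))) := by
  rw [← Fintype.sum_prod_type' fun c a => F (restr q (glue p a (Function.update h₀ k c)))]
  symm
  refine Fintype.sum_equiv
    ⟨fun x => restr q (glue p x.2 (Function.update h₀ k x.1)),
      fun x => (glue q x h₀ k, restr p (glue q x h₀)), ?_, ?_⟩ _ _ fun x => rfl
  · rintro ⟨c, a⟩
    have e : ∀ l, q l → glue q (restr q (glue p a (Function.update h₀ k c))) h₀ l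
        = glue p a (Function.update h₀ k c) l := fun l hl => by
      rw [glue_restr_apply, if_pos hl]
    refine Prod.ext ?_ ?_
    · simp only
      rw [e k ((hq k).2 (Or.inr rfl)), glue_apply_of_not hk, Function.update_self]
    · simp only
      rw [restr_eq_restr.2 fun l hl => e l ((hq l).2 (Or.inl hl)), restr_glue]
  · intro x
    simp only
    conv_rhs => rw [← restr_glue x h₀]
    rw [restr_eq_restr]
    intro l hl
    rw [glue_restr_apply]
    split_ifs with hp
    · rfl
    · obtain rfl := ((hq l).1 hl).resolve_left hp
      rw [Function.update_self]

/-- `W'` is the left unfolding of `G` multiplied by the isometry `W ⊗ 1`, so both have the same Gram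
matrix. -/
theorem left_transpose_mul_left [Nonempty (Idx n)] (hk : ¬ p k) (hq : ∀ l, q l ↔ p l ∨ l = k)
    {r s : ℕ} {W : Matrix ((j : {j // p j}) → Fin (n j)) (Fin r) ℝ}
    {W' : Matrix ((j : {j // q j}) → Fin (n j)) (Fin s) ℝ} (hW : Wᵀ * W = 1) (hW' : W'ᵀ * W' = 1)
    {G : Core r (n k) s}
    (hG : ∀ (h : Idx n) β, W' (restr q h) β = ∑ α, W (restr p h) α * G (h k) α β) :
    (Core.left G)ᵀ * Core.left G = 1 := by
  rw [← hW']
  ext β β'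
  simp only [mul_apply, transpose_apply, Core.left, of_apply]
  rw [sum_restr_eq hk hq (Classical.arbitrary _), Fintype.sum_prod_type]
  refine Finset.sum_congr rfl fun c _ => ?_
  simp only [hG, restr_glue, glue_apply_of_not hk, Function.update_self]
  have hW2 : ∀ α α', ∑ a, W a α * W a α' = if α = α' then 1 else 0 := fun α α' => by
    have := congrFun (congrFun hW α) α'
    rwa [mul_apply, one_apply] at this
  have e : ∀ a, (∑ α, W a α * G c α β) * (∑ α, W a α * G c α β')
      = ∑ α, ∑ α', (W a α * W a α') * (G c α β * G c α' β') := fun a => by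
    rw [Finset.sum_mul_sum]
    exact Finset.sum_congr rfl fun α _ => Finset.sum_congr rfl fun α' _ => by ring
  simp only [e]
  rw [Finset.sum_comm]
  refine Finset.sum_congr rfl fun α _ => ?_
  rw [Finset.sum_comm]
  simp only [← Finset.sum_mul, hW2, ite_mul, one_mul, zero_mul, Finset.sum_ite_eq,
    Finset.mem_univ, if_true]

end CoreStep

section Contraction

theorem sum_prod_forward {d : ℕ} {r : Fin (d + 1) → ℕ}
    (M : (k : Fin d) → Matrix (Fin (r k.castSucc)) (Fin (r k.succ)) ℝ)
    (x : (k : Fin (d + 1)) → Fin (r k) → ℝ)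
    (hx : ∀ k : Fin d, ∀ β, x k.succ β = ∑ α, x k.castSucc α * M k α β) :
    ∑ α : ((k : Fin (d + 1)) → Fin (r k)), x 0 (α 0) * ∏ k : Fin d, M k (α k.castSucc) (α k.succ)
      = ∑ β, x (Fin.last d) β := by
  induction d with
  | zero =>
    simp only [Finset.univ_eq_empty, Finset.prod_empty, mul_one]
    rw [← (Fin.consEquiv fun k : Fin 1 => Fin (r k)).sum_comp, Fintype.sum_prod_type]
    simp [Fin.consEquiv]
  | succ d ih =>
    rw [← (Fin.consEquiv fun k : Fin (d + 1 + 1) => Fin (r k)).sum_comp, Fintype.sum_prod_type_right]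
    have := ih (r := fun k => r k.succ) (fun k => M k.succ) (fun k => x k.succ)
      (fun k β => hx k.succ β)
    refine Eq.trans (Finset.sum_congr rfl fun α _ => ?_) this
    have h0 := hx 0 (α 0)
    change x (Fin.succ 0) (α 0) = _ at h0
    rw [h0, Finset.sum_mul]
    refine Finset.sum_congr rfl fun a _ => ?_
    rw [Fin.prod_univ_succ, ← mul_assoc]
    rfl

/-- The induction removes cores from the left although the recursion for `y` runs from the right;
the free vector `g` absorbs each removed core. -/
theorem sum_prod_backward {d : ℕ} {r : Fin (d + 1) → ℕ}
    (M : (k : Fin d) → Matrix (Fin (r k.castSucc)) (Fin (r k.succ)) ℝ)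
    (y : (k : Fin (d + 1)) → Fin (r k) → ℝ)
    (hy : ∀ k : Fin d, ∀ α, y k.castSucc α = ∑ β, M k α β * y k.succ β) (g : Fin (r 0) → ℝ) :
    ∑ α : ((k : Fin (d + 1)) → Fin (r k)), g (α 0) *
        (∏ k : Fin d, M k (α k.castSucc) (α k.succ)) * y (Fin.last d) (α (Fin.last d))
      = ∑ α, g α * y 0 α := by
  induction d with
  | zero =>
    simp only [Finset.univ_eq_empty, Finset.prod_empty, mul_one]
    rw [← (Fin.consEquiv fun k : Fin 1 => Fin (r k)).sum_comp, Fintype.sum_prod_type]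
    simp [Fin.consEquiv]
  | succ d ih =>
    rw [← (Fin.consEquiv fun k : Fin (d + 1 + 1) => Fin (r k)).sum_comp, Fintype.sum_prod_type_right]
    have := ih (r := fun k => r k.succ) (fun k => M k.succ) (fun k => y k.succ)
      (fun k β => hy k.succ β) (fun β => ∑ α, g α * M 0 α β)
    refine Eq.trans (Finset.sum_congr rfl fun α _ => ?_) (this.trans ?_)
    · simp only [Finset.sum_mul]
      refine Finset.sum_congr rfl fun a _ => ?_
      rw [Fin.prod_univ_succ, ← mul_assoc]
      rfl
    · simp only [Finset.sum_mul]
      rw [Finset.sum_comm]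
      refine Finset.sum_congr rfl fun a _ => ?_
      have h0 := hy 0 a
      change y 0 a = _ at h0
      rw [h0, Finset.mul_sum]
      exact Finset.sum_congr rfl fun b _ => mul_assoc _ _ _

end Contraction

end TensorTrain

/-! ### Existence of left- and right-orthogonal representations -/

namespace TensorTrain

open Matrix

section Existence

variable {d : ℕ} {n : Fin d → ℕ}

theorem ttRank_zero (A : Tensor n) : ttRank A 0 = 1 := by simp [ttRank]

theorem ttRank_last (A : Tensor n) : ttRank A (Fin.last d) = 1 := by simp [ttRank]

theorem ttRank_of_ne (A : Tensor n) {k : Fin (d + 1)} (h0 : k ≠ 0) (hl : k ≠ Fin.last d) :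
    ttRank A k = (unfolding k A).rank := by simp [ttRank, h0, hl]

theorem const_gram {a : Type*} [Fintype a] [Unique a] [DecidableEq a] {r : ℕ} (hr : r = 1)
    {W : Matrix a (Fin r) ℝ} (hW : ∀ a α, W a α = 1) : Wᵀ * W = 1 ∧ W * Wᵀ = 1 := by
  subst hr
  constructor
  · ext α β
    obtain rfl := Subsingleton.elim α β
    simp [mul_apply, hW]
  · ext α β
    obtain rfl := Subsingleton.elim α β
    simp [mul_apply, hW]

/-- Boundary conventions: the interface is the constant `1` at `k = 0`, and the tensor `A` itself,
as one unnormalised column, at `k = d`. Hence orthonormality excludes the last index and membership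
in the slices excludes the first. -/
theorem exists_left_family (hd : 0 < d) [Nonempty (Idx n)] (A : Tensor n) :
    ∃ W : (k : Fin (d + 1)) →
        Matrix ((j : {j : Fin d // (j : ℕ) < k}) → Fin (n j)) (Fin (ttRank A k)) ℝ,
      (∀ k : Fin (d + 1), k ≠ Fin.last d → (W k)ᵀ * W k = 1 ∧
        lift (fun j : Fin d => (j : ℕ) < k) (W k * (W k)ᵀ) *ᵥ A.ofLp = A.ofLp) ∧
      (∀ k : Fin (d + 1), k ≠ 0 → ∀ β, (fun h => W k (restr _ h) β) ∈
        slices (fun j : Fin d => (j : ℕ) < k) A.ofLp) ∧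
      (∀ a α, W 0 a α = 1) ∧ ∀ h β, W (Fin.last d) (restr _ h) β = A h := by
  have hne : (0 : Fin (d + 1)) ≠ Fin.last d := by
    rw [Ne, Fin.ext_iff, Fin.val_zero, Fin.val_last]; omega
  have key : ∀ k : Fin (d + 1), ∃ W : Matrix ((j : {j : Fin d // (j : ℕ) < k}) → Fin (n j))
      (Fin (ttRank A k)) ℝ,
      (k ≠ Fin.last d → Wᵀ * W = 1 ∧
        lift (fun j : Fin d => (j : ℕ) < k) (W * Wᵀ) *ᵥ A.ofLp = A.ofLp) ∧
      (k ≠ 0 → ∀ β, (fun h => W (restr _ h) β) ∈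
        slices (fun j : Fin d => (j : ℕ) < k) A.ofLp) ∧
      (k = 0 → ∀ a α, W a α = 1) ∧ (k = Fin.last d → ∀ h β, W (restr _ h) β = A h) := by
    intro k
    by_cases h0 : k = 0
    · subst h0
      have : IsEmpty {j : Fin d // (j : ℕ) < (0 : Fin (d + 1))} := ⟨fun j => by simpa using j.2⟩
      have hg := const_gram (W := of fun (_ : (j : {j : Fin d // (j : ℕ) < (0 : Fin (d + 1))}) →
        Fin (n j)) (_ : Fin (ttRank A 0)) => (1 : ℝ)) (ttRank_zero A) fun _ _ => rfl
      refine ⟨_, fun _ => ⟨hg.1, ?_⟩, fun h => absurd rfl h, fun _ _ _ => rfl,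
        fun h => absurd h hne⟩
      rw [hg.2, lift_one, one_mulVec]
    · by_cases hl : k = Fin.last d
      · subst hl
        refine ⟨of fun a _ => A.ofLp (glue _ a (Classical.arbitrary _)), fun h => absurd rfl h,
          fun _ _ => Submodule.subset_span ⟨Classical.arbitrary _, rfl⟩,
          fun h => absurd h h0, fun _ h β => ?_⟩
        rw [of_apply]
        refine congrArg A.ofLp (funext fun l => ?_)
        rw [glue_restr_apply, if_pos]
        exact l.2
      · obtain ⟨W, h1, h2, h3⟩ := exists_left_interface A k _ (ttRank_of_ne A h0 hl)
        exact ⟨W, fun _ => ⟨h1, h2⟩, fun _ => h3, fun h => absurd h h0, fun h => absurd h hl⟩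
  choose W h1 h2 h3 h4 using key
  exact ⟨W, h1, h2, h3 0 rfl, h4 _ rfl⟩

theorem exists_right_family (hd : 0 < d) [Nonempty (Idx n)] (A : Tensor n) :
    ∃ W : (k : Fin (d + 1)) →
        Matrix ((j : {j : Fin d // ¬ (j : ℕ) < k}) → Fin (n j)) (Fin (ttRank A k)) ℝ,
      (∀ k : Fin (d + 1), k ≠ 0 → (W k)ᵀ * W k = 1 ∧
        lift (fun j : Fin d => ¬ (j : ℕ) < k) (W k * (W k)ᵀ) *ᵥ A.ofLp = A.ofLp) ∧
      (∀ k : Fin (d + 1), k ≠ Fin.last d → ∀ β, (fun h => W k (restr _ h) β) ∈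
        slices (fun j : Fin d => ¬ (j : ℕ) < k) A.ofLp) ∧
      (∀ a α, W (Fin.last d) a α = 1) ∧ ∀ h β, W 0 (restr _ h) β = A h := by
  have hne : (0 : Fin (d + 1)) ≠ Fin.last d := by
    rw [Ne, Fin.ext_iff, Fin.val_zero, Fin.val_last]; omega
  have key : ∀ k : Fin (d + 1), ∃ W : Matrix ((j : {j : Fin d // ¬ (j : ℕ) < k}) → Fin (n j))
      (Fin (ttRank A k)) ℝ,
      (k ≠ 0 → Wᵀ * W = 1 ∧
        lift (fun j : Fin d => ¬ (j : ℕ) < k) (W * Wᵀ) *ᵥ A.ofLp = A.ofLp) ∧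
      (k ≠ Fin.last d → ∀ β, (fun h => W (restr _ h) β) ∈
        slices (fun j : Fin d => ¬ (j : ℕ) < k) A.ofLp) ∧
      (k = Fin.last d → ∀ a α, W a α = 1) ∧ (k = 0 → ∀ h β, W (restr _ h) β = A h) := by
    intro k
    by_cases hl : k = Fin.last d
    · subst hl
      have : IsEmpty {j : Fin d // ¬ (j : ℕ) < Fin.last d} :=
        ⟨fun j => j.2 j.1.2⟩
      have hg := const_gram (W := of fun (_ : (j : {j : Fin d // ¬ (j : ℕ) < Fin.last d}) →
        Fin (n j)) (_ : Fin (ttRank A (Fin.last d))) => (1 : ℝ)) (ttRank_last A) fun _ _ => rfl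
      refine ⟨_, fun _ => ⟨hg.1, ?_⟩, fun h => absurd rfl h, fun _ _ _ => rfl,
        fun h => absurd h.symm hne⟩
      rw [hg.2, lift_one, one_mulVec]
    · by_cases h0 : k = 0
      · subst h0
        refine ⟨of fun a _ => A.ofLp (glue _ a (Classical.arbitrary _)), fun h => absurd rfl h,
          fun _ _ => Submodule.subset_span ⟨Classical.arbitrary _, rfl⟩,
          fun h => absurd h hl, fun _ h β => ?_⟩
        rw [of_apply]
        refine congrArg A.ofLp (funext fun l => ?_)
        rw [glue_restr_apply, if_pos]
        simp
      · obtain ⟨W, h1, h2, h3⟩ := exists_right_interface A k _ (ttRank_of_ne A h0 hl)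
        exact ⟨W, fun _ => ⟨h1, h2⟩, fun _ => h3, fun h => absurd h hl, fun h => absurd h h0⟩
  choose W h1 h2 h3 h4 using key
  exact ⟨W, h1, h2, h3 _ rfl, h4 _ rfl⟩

/-- Column spaces are nested, so each interface factors through the previous one, and the factors
are the cores. The interfaces are returned as well: projections are built from them, while coherence
concerns the cores, and the recursion links the two. -/
theorem exists_leftOrthogonal (hd : 0 < d) [Nonempty (Idx n)] (A : Tensor n) :
    ∃ (U : TTCores n (ttRank A)) (W : (k : Fin (d + 1)) →
        Matrix ((j : {j : Fin d // (j : ℕ) < k}) → Fin (n j)) (Fin (ttRank A k)) ℝ),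
      U.IsLeftOrthogonal ∧ U.toTensor = A ∧
      (∀ k : Fin (d + 1), k ≠ Fin.last d → (W k)ᵀ * W k = 1 ∧
        lift (fun j : Fin d => (j : ℕ) < k) (W k * (W k)ᵀ) *ᵥ A.ofLp = A.ofLp) ∧
      (∀ k : Fin (d + 1), k ≠ 0 → ∀ β, (fun h => W k (restr _ h) β) ∈
        slices (fun j : Fin d => (j : ℕ) < k) A.ofLp) ∧
      (∀ a α, W 0 a α = 1) ∧
      ∀ (k : Fin d) (h : Idx n) β, W k.succ (restr _ h) β
        = ∑ α, W k.castSucc (restr _ h) α * U k (h k) α β := by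
  obtain ⟨W, h1, h2, h3, h4⟩ := exists_left_family hd A
  have hnot : ∀ k : Fin d, ¬ (k : ℕ) < (k.castSucc : Fin (d + 1)) := fun k => by simp
  have hstep : ∀ k l : Fin d, (l : ℕ) < (k.succ : Fin (d + 1)) ↔
      (l : ℕ) < (k.castSucc : Fin (d + 1)) ∨ l = k := fun k l => by
    rw [Fin.ext_iff, Fin.val_succ, Fin.val_castSucc]; omega
  have hcore : ∀ k : Fin d, ∃ G : Core (ttRank A k.castSucc) (n k) (ttRank A k.succ),
      ∀ (h : Idx n) β, W k.succ (restr _ h) β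
        = ∑ α, W k.castSucc (restr _ h) α * G (h k) α β := fun k =>
    exists_core_of_lift_mulVec_eq (hnot k) (hstep k) _ _ fun β =>
      lift_mulVec_of_mem_slices (fun l hl => (hstep k l).2 (Or.inl hl))
        (h1 _ (Fin.castSucc_lt_last k).ne).2 (h2 _ (Fin.succ_ne_zero k) β)
  choose U hU using hcore
  refine ⟨U, W, fun k hk => ?_, ?_, h1, h2, h3, hU⟩
  · refine left_transpose_mul_left (hnot k) (hstep k) (h1 _ (Fin.castSucc_lt_last k).ne).1
      (h1 _ ?_).1 (hU k)
    rw [Ne, Fin.ext_iff, Fin.val_succ, Fin.val_last]; omega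
  · ext h
    have := sum_prod_forward (fun k => U k (h k)) (fun k => W k (restr _ h)) fun k => hU k h
    simp only [h3, one_mul, h4, Finset.sum_const, Finset.card_univ, Fintype.card_fin,
      ttRank_last, one_smul] at this
    exact this

theorem exists_rightOrthogonal (hd : 0 < d) [Nonempty (Idx n)] (A : Tensor n) :
    ∃ (V : TTCores n (ttRank A)) (W : (k : Fin (d + 1)) →
        Matrix ((j : {j : Fin d // ¬ (j : ℕ) < k}) → Fin (n j)) (Fin (ttRank A k)) ℝ),
      V.IsRightOrthogonal ∧ V.toTensor = A ∧
      (∀ k : Fin (d + 1), k ≠ 0 → (W k)ᵀ * W k = 1 ∧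
        lift (fun j : Fin d => ¬ (j : ℕ) < k) (W k * (W k)ᵀ) *ᵥ A.ofLp = A.ofLp) ∧
      (∀ a α, W (Fin.last d) a α = 1) ∧
      ∀ (k : Fin d) (h : Idx n) α, W k.castSucc (restr _ h) α
        = ∑ β, V k (h k) α β * W k.succ (restr _ h) β := by
  obtain ⟨W, h1, h2, h3, h4⟩ := exists_right_family hd A
  have hnot : ∀ k : Fin d, ¬ ¬ (k : ℕ) < (k.succ : Fin (d + 1)) := fun k => by simp
  have hstep : ∀ k l : Fin d, ¬ (l : ℕ) < (k.castSucc : Fin (d + 1)) ↔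
      ¬ (l : ℕ) < (k.succ : Fin (d + 1)) ∨ l = k := fun k l => by
    rw [Fin.ext_iff, Fin.val_succ, Fin.val_castSucc]; omega
  -- Built from the right end, the cores come out with their two rank indices exchanged; their
  -- slices are transposed below.
  have hcore : ∀ k : Fin d, ∃ G : Core (ttRank A k.succ) (n k) (ttRank A k.castSucc),
      ∀ (h : Idx n) β, W k.castSucc (restr _ h) β
        = ∑ α, W k.succ (restr _ h) α * G (h k) α β := fun k =>
    exists_core_of_lift_mulVec_eq (hnot k) (hstep k) _ _ fun β =>
      lift_mulVec_of_mem_slices (fun l hl => (hstep k l).2 (Or.inl hl))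
        (h1 _ (Fin.succ_ne_zero k)).2 (h2 _ (Fin.castSucc_lt_last k).ne β)
  choose G hG using hcore
  have hV : ∀ (k : Fin d) (h : Idx n) α, W k.castSucc (restr _ h) α
      = ∑ β, (G k (h k))ᵀ α β * W k.succ (restr _ h) β := fun k h α => by
    rw [hG]; exact Finset.sum_congr rfl fun β _ => mul_comm _ _
  refine ⟨fun k i => (G k i)ᵀ, W, fun k hk => ?_, ?_, h1, h3, hV⟩
  · have := left_transpose_mul_left (hnot k) (hstep k) (h1 _ (Fin.succ_ne_zero k)).1
      (h1 k.castSucc ?_).1 (hG k)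
    · rw [← this]
      ext α α'
      simp only [mul_apply, transpose_apply, Core.left, Core.right, of_apply]
    · rw [Ne, Fin.ext_iff, Fin.val_castSucc, Fin.val_zero]; omega
  · ext h
    have := sum_prod_backward (fun k => (G k (h k))ᵀ) (fun k => W k (restr _ h))
      (fun k => hV k h) fun _ => 1
    simp only [h3, one_mul, mul_one, h4, Finset.sum_const, Finset.card_univ, Fintype.card_fin,
      ttRank_zero, one_smul] at this
    exact this

end Existence

/-! ### Core coherence and the row norms of the interfaces -/

section Coherence

open scoped Matrix.Norms.L2Operator

theorem sum_sq_mulVec_le {a b : Type*} [Fintype a] [Fintype b] [DecidableEq a] [DecidableEq b]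
    (G : Matrix a b ℝ) (x : b → ℝ) : ∑ i, (∑ j, G i j * x j) ^ 2 ≤ ‖G‖ ^ 2 * ∑ j, x j ^ 2 := by
  have h := l2_opNorm_mulVec G (WithLp.toLp 2 x)
  have h2 := pow_le_pow_left₀ (norm_nonneg _) h 2
  rw [mul_pow, EuclideanSpace.norm_sq_eq, EuclideanSpace.norm_sq_eq] at h2
  simpa [mulVec, dotProduct] using h2

theorem sum_sq_vecMul_le {a b : Type*} [Fintype a] [Fintype b] [DecidableEq a] [DecidableEq b]
    (G : Matrix a b ℝ) (x : a → ℝ) : ∑ j, (∑ i, x i * G i j) ^ 2 ≤ ‖G‖ ^ 2 * ∑ i, x i ^ 2 := by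
  have h := sum_sq_mulVec_le Gᵀ x
  rw [← conjTranspose_eq_transpose_of_trivial, l2_opNorm_conjTranspose] at h
  simpa [mul_comm] using h

theorem norm_le_one_of_sum_sq_le {a b : Type*} [Fintype a] [Fintype b] [DecidableEq a]
    [DecidableEq b] {G : Matrix a b ℝ}
    (h : ∀ x : b → ℝ, ∑ i, (∑ j, G i j * x j) ^ 2 ≤ ∑ j, x j ^ 2) : ‖G‖ ≤ 1 := by
  rw [l2_opNorm_def]
  refine ContinuousLinearMap.opNorm_le_bound _ zero_le_one fun x => ?_
  rw [one_mul]
  refine le_of_sq_le_sq ?_ (norm_nonneg _)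
  rw [EuclideanSpace.norm_sq_eq, EuclideanSpace.norm_sq_eq]
  simpa [mulVec, dotProduct, toLpLin_apply] using h x

/-- A slice is a block of rows of an isometry. The bound makes the set in `leftCoreCoherence`
bounded above, without which its real supremum would have the default value `0`. -/
theorem norm_slice_le_one_of_left {r n s : ℕ} {G : Core r n s}
    (hG : (Core.left G)ᵀ * Core.left G = 1) (i : Fin n) : ‖G i‖ ≤ 1 := by
  refine norm_le_one_of_sum_sq_le fun x => ?_
  have h1 : ∑ p, (Core.left G *ᵥ x) p ^ 2 = ∑ j, x j ^ 2 := by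
    have : (Core.left G *ᵥ x) ⬝ᵥ (Core.left G *ᵥ x) = x ⬝ᵥ x := by
      rw [dotProduct_mulVec, vecMul_mulVec, hG, vecMul_one]
    simpa [dotProduct, pow_two] using this
  rw [← h1, Fintype.sum_prod_type]
  exact Finset.single_le_sum (f := fun c => ∑ α, (Core.left G *ᵥ x) (c, α) ^ 2)
    (fun c _ => Finset.sum_nonneg fun α _ => sq_nonneg _) (Finset.mem_univ i)

theorem norm_slice_transpose_le_one_of_right {r n s : ℕ} {G : Core r n s}
    (hG : Core.right G * (Core.right G)ᵀ = 1) (i : Fin n) : ‖(G i)ᵀ‖ ≤ 1 := by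
  refine norm_slice_le_one_of_left (G := fun i => (G i)ᵀ) ?_ i
  rw [← hG]
  ext α α'
  simp only [mul_apply, transpose_apply, Core.left, Core.right, of_apply]

variable {d : ℕ} {n : Fin d → ℕ}

theorem iSup_sq_le_one {n : ℕ} {f : Fin n → ℝ} (h0 : ∀ i, 0 ≤ f i) (h : ∀ i, f i ≤ 1) :
    ⨆ i, f i ^ 2 ≤ 1 :=
  Real.iSup_le (fun i => pow_le_one₀ (h0 i) (h i)) zero_le_one

/-- One representation is only compared with the supremum over all of them, so independence of the
representation plays no role. -/
theorem leftCoherence_le_coreCoherence {A : Tensor n} {U : TTCores n (ttRank A)}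
    (hU : U.IsLeftOrthogonal) (hUA : U.toTensor = A) {k : Fin d} (hk : (k : ℕ) + 1 < d) :
    Core.leftCoherence (U k) ≤ coreCoherence A := by
  refine le_trans ?_ (le_max_left _ _)
  refine le_trans ?_ (le_ciSup (f := fun k : {k : Fin d // (k : ℕ) + 1 < d} =>
    leftCoreCoherence A k) (Set.finite_range _).bddAbove ⟨k, hk⟩)
  refine le_csSup ⟨ttRank A k.castSucc * n k / ttRank A k.succ * 1, ?_⟩ ⟨U, hU, hUA, rfl⟩
  rintro _ ⟨U', hU', -, rfl⟩
  exact mul_le_mul_of_nonneg_left (iSup_sq_le_one (fun i => norm_nonneg _)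
    fun i => norm_slice_le_one_of_left (hU' k hk) i) (by positivity)

theorem rightCoherence_le_coreCoherence {A : Tensor n} {V : TTCores n (ttRank A)}
    (hV : V.IsRightOrthogonal) (hVA : V.toTensor = A) {k : Fin d} (hk : 0 < (k : ℕ)) :
    Core.rightCoherence (V k) ≤ coreCoherence A := by
  refine le_trans ?_ (le_max_right _ _)
  refine le_trans ?_ (le_ciSup (f := fun k : {k : Fin d // 0 < (k : ℕ)} =>
    rightCoreCoherence A k) (Set.finite_range _).bddAbove ⟨k, hk⟩)
  refine le_csSup ⟨ttRank A k.succ * n k / ttRank A k.castSucc * 1, ?_⟩ ⟨V, hV, hVA, rfl⟩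
  rintro _ ⟨V', hV', -, rfl⟩
  exact mul_le_mul_of_nonneg_left (iSup_sq_le_one (fun i => norm_nonneg _)
    fun i => norm_slice_transpose_le_one_of_right (hV' k hk) i) (by positivity)

theorem norm_sq_slice_le_of_leftCoherence_le {r n s : ℕ} {G : Core r n s} {μ : ℝ} (hr : 0 < r)
    (hs : 0 < s) (hG : Core.leftCoherence G ≤ μ) (i : Fin n) : ‖G i‖ ^ 2 ≤ μ * s / (r * n) := by
  have hn : 0 < n := i.pos
  have h1 : ‖G i‖ ^ 2 ≤ ⨆ i, ‖G i‖ ^ 2 :=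
    le_ciSup (f := fun i => ‖G i‖ ^ 2) (Set.finite_range _).bddAbove i
  have hr' : (0 : ℝ) < r := by exact_mod_cast hr
  have hs' : (0 : ℝ) < s := by exact_mod_cast hs
  have hn' : (0 : ℝ) < n := by exact_mod_cast hn
  rw [Core.leftCoherence] at hG
  refine h1.trans ?_
  rw [le_div_iff₀ (by positivity)]
  rw [div_mul_eq_mul_div, div_le_iff₀ hs'] at hG
  linarith

theorem norm_sq_slice_le_of_rightCoherence_le {r n s : ℕ} {G : Core r n s} {μ : ℝ} (hr : 0 < r)
    (hs : 0 < s) (hG : Core.rightCoherence G ≤ μ) (i : Fin n) : ‖G i‖ ^ 2 ≤ μ * r / (s * n) := by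
  have := norm_sq_slice_le_of_leftCoherence_le (G := fun i => (G i)ᵀ) hs hr hG i
  rwa [← conjTranspose_eq_transpose_of_trivial, l2_opNorm_conjTranspose] at this

theorem coreCoherence_nonneg (A : Tensor n) : 0 ≤ coreCoherence A := by
  refine le_max_of_le_left (Real.iSup_nonneg fun k => Real.sSup_nonneg ?_)
  rintro _ ⟨U, -, -, rfl⟩
  exact mul_nonneg (by positivity) (Real.iSup_nonneg fun i => sq_nonneg _)

/-- Each core multiplies the squared norm by at most `μ r_{k+1} / (r_k n_k)`, and the ranks
telescope. The last core is not orthogonal, so the bound stops before it. -/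
theorem sum_sq_forward_le {r : Fin (d + 1) → ℕ} (hr : ∀ k, 0 < r k) (hr0 : r 0 = 1)
    (hn : ∀ k, 0 < n k) {μ : ℝ} (hμ : 0 ≤ μ)
    (M : (k : Fin d) → Matrix (Fin (r k.castSucc)) (Fin (r k.succ)) ℝ)
    (hM : ∀ k : Fin d, (k : ℕ) + 1 < d →
      ‖M k‖ ^ 2 ≤ μ * r k.succ / (r k.castSucc * n k))
    (x : (k : Fin (d + 1)) → Fin (r k) → ℝ) (hx0 : ∀ α, x 0 α = 1)
    (hx : ∀ k : Fin d, ∀ β, x k.succ β = ∑ α, x k.castSucc α * M k α β)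
    (k : Fin (d + 1)) (hk : (k : ℕ) < d) :
    ∑ α, x k α ^ 2 ≤ r k * μ ^ (k : ℕ) / ∏ j ∈ ({j : Fin d | (j : ℕ) < k} : Finset (Fin d)), (n j : ℝ) := by
  induction k using Fin.induction with
  | zero => simp [hx0, hr0]
  | succ k ih =>
    have hk' : (k : ℕ) + 1 < d := by simpa using hk
    have h1 := ih (by rw [Fin.val_castSucc]; omega)
    have hset : ({j : Fin d | (j : ℕ) < (k.succ : Fin (d + 1))} : Finset (Fin d))
        = insert k ({j : Fin d | (j : ℕ) < (k.castSucc : Fin (d + 1))} : Finset (Fin d)) := by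
      ext j
      simp [Fin.ext_iff]
      omega
    rw [hset, Finset.prod_insert (by simp)]
    simp only [hx]
    refine (sum_sq_vecMul_le _ _).trans ((mul_le_mul (hM k hk') h1
      (Finset.sum_nonneg fun _ _ => sq_nonneg _) (by positivity)).trans (le_of_eq ?_))
    have hnk : (n k : ℝ) ≠ 0 := by exact_mod_cast (hn k).ne'
    have hrk : (r k.castSucc : ℝ) ≠ 0 := by exact_mod_cast (hr _).ne'
    have hprod : ∏ j ∈ ({j : Fin d | (j : ℕ) < (k.castSucc : Fin (d + 1))} : Finset (Fin d)), (n j : ℝ) ≠ 0 :=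
      Finset.prod_ne_zero_iff.2 fun j _ => by exact_mod_cast (hn j).ne'
    rw [Fin.val_succ, Fin.val_castSucc, pow_succ]
    rw [Fin.val_castSucc] at hprod
    field_simp

theorem sum_sq_backward_le {r : Fin (d + 1) → ℕ} (hr : ∀ k, 0 < r k) (hrd : r (Fin.last d) = 1)
    (hn : ∀ k, 0 < n k) {μ : ℝ} (hμ : 0 ≤ μ)
    (M : (k : Fin d) → Matrix (Fin (r k.castSucc)) (Fin (r k.succ)) ℝ)
    (hM : ∀ k : Fin d, 0 < (k : ℕ) →
      ‖M k‖ ^ 2 ≤ μ * r k.castSucc / (r k.succ * n k))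
    (y : (k : Fin (d + 1)) → Fin (r k) → ℝ) (hy0 : ∀ α, y (Fin.last d) α = 1)
    (hy : ∀ k : Fin d, ∀ α, y k.castSucc α = ∑ β, M k α β * y k.succ β)
    (k : Fin (d + 1)) (hk : 0 < (k : ℕ)) :
    ∑ α, y k α ^ 2 ≤ r k * μ ^ (d - k : ℕ) / ∏ j ∈ ({j : Fin d | ¬ (j : ℕ) < k} : Finset (Fin d)), (n j : ℝ) := by
  induction k using Fin.reverseInduction with
  | last => simp [hy0, hrd]
  | cast k ih =>
    have hk' : 0 < (k : ℕ) := by simpa using hk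
    have h1 := ih (by simp)
    have hset : ({j : Fin d | ¬ (j : ℕ) < (k.castSucc : Fin (d + 1))} : Finset (Fin d))
        = insert k ({j : Fin d | ¬ (j : ℕ) < (k.succ : Fin (d + 1))} : Finset (Fin d)) := by
      ext j
      simp [Fin.ext_iff]
      omega
    rw [hset, Finset.prod_insert (by simp)]
    simp only [hy]
    refine (sum_sq_mulVec_le _ _).trans ((mul_le_mul (hM k hk') h1
      (Finset.sum_nonneg fun _ _ => sq_nonneg _) (by positivity)).trans (le_of_eq ?_))
    have hnk : (n k : ℝ) ≠ 0 := by exact_mod_cast (hn k).ne'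
    have hrk : (r k.succ : ℝ) ≠ 0 := by exact_mod_cast (hr _).ne'
    have hprod : ∏ j ∈ ({j : Fin d | ¬ (j : ℕ) < (k.succ : Fin (d + 1))} : Finset (Fin d)), (n j : ℝ) ≠ 0 :=
      Finset.prod_ne_zero_iff.2 fun j _ => by exact_mod_cast (hn j).ne'
    rw [Fin.val_castSucc, show d - (k : ℕ) = d - (k.succ : Fin (d + 1)) + 1 by
      rw [Fin.val_succ]; omega, pow_succ]
    field_simp

end Coherence

end TensorTrain

/-! ### Velocities of curves of matrices of bounded rank -/

namespace TensorTrain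

open Matrix Filter Topology

section Tangent

variable {a b : Type*} [Fintype a] [Fintype b]

/-- Invertibility of `Y Γ X` forces `Γ X` to have the full range of `Γ`, so `Γ x = Γ X c`, and
applying `Y` recovers `c`. The correction thus moves `x` into the kernel of `Γ`. -/
theorem mulVec_sub_eq_zero_of_rank_le {r : ℕ} {Γ : Matrix a b ℝ} (hr : Γ.rank ≤ r)
    (Y : Matrix (Fin r) a ℝ) (X : Matrix b (Fin r) ℝ) (hS : IsUnit (Y * Γ * X).det) (x : b → ℝ) :
    Γ *ᵥ (x - X *ᵥ ((Y * Γ * X)⁻¹ *ᵥ ((Y * Γ) *ᵥ x))) = 0 := by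
  have hSr : (Y * Γ * X).rank = r := by
    rw [rank_of_isUnit _ ((isUnit_iff_isUnit_det _).2 hS), Fintype.card_fin]
  have hle : LinearMap.range (Γ * X).mulVecLin ≤ LinearMap.range Γ.mulVecLin := by
    rw [mulVecLin_mul]
    exact LinearMap.range_comp_le_range _ _
  have hrank : Γ.rank ≤ (Γ * X).rank := by
    refine hr.trans ?_
    conv_lhs => rw [← hSr, Matrix.mul_assoc]
    exact rank_mul_le_right _ _
  have heq := Submodule.eq_of_le_of_finrank_le hle hrank
  have hmem : Γ *ᵥ x ∈ LinearMap.range (Γ * X).mulVecLin := by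
    rw [heq]; exact ⟨x, rfl⟩
  obtain ⟨c, hc⟩ := hmem
  rw [mulVecLin_apply] at hc
  have h1 : (Y * Γ) *ᵥ x = (Y * Γ * X) *ᵥ c := by
    rw [← mulVec_mulVec, ← hc, mulVec_mulVec, Matrix.mul_assoc]
  have h2 : (Y * Γ * X)⁻¹ *ᵥ ((Y * Γ * X) *ᵥ c) = c := by
    rw [mulVec_mulVec, nonsing_inv_mul _ hS, one_mulVec]
  rw [h1, h2, mulVec_sub, mulVec_mulVec, hc, sub_self]

omit [Fintype a] in
theorem tendsto_mulVec {α : Type*} {l : Filter α} {F : α → Matrix a b ℝ} {g : α → b → ℝ}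
    {M : Matrix a b ℝ} {v : b → ℝ} (hF : Tendsto F l (𝓝 M)) (hg : Tendsto g l (𝓝 v)) :
    Tendsto (fun t => F t *ᵥ g t) l (𝓝 (M *ᵥ v)) :=
  tendsto_pi_nhds.2 fun i => tendsto_finsetSum _ fun j _ =>
    (tendsto_pi_nhds.1 (tendsto_pi_nhds.1 hF i) j).mul (tendsto_pi_nhds.1 hg j)

variable [DecidableEq a] [DecidableEq b]

/-- The velocity of a curve of matrices whose rank does not exceed its initial value vanishes on
the kernel, modulo the range. -/
theorem dotProduct_deriv_mulVec_eq_zero {Γ : ℝ → Matrix a b ℝ} {Γ' : Matrix a b ℝ}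
    (hΓ : ∀ i j, HasDerivAt (fun t => Γ t i j) (Γ' i j) 0)
    (hrank : ∀ᶠ t in 𝓝 (0 : ℝ), (Γ t).rank ≤ (Γ 0).rank) {x : b → ℝ} {y : a → ℝ}
    (hx : Γ 0 *ᵥ x = 0) (hy : y ᵥ* Γ 0 = 0) : y ⬝ᵥ Γ' *ᵥ x = 0 := by
  obtain ⟨r, hr, W, Z, hW1, hZ⟩ : ∃ r, (Γ 0).rank = r ∧ ∃ (W : Matrix a (Fin r) ℝ)
      (Z : Matrix b (Fin r) ℝ), Wᵀ * W = 1 ∧ W = Γ 0 * Z := by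
    obtain ⟨W, hW1, -, Z, hZ⟩ := exists_orthonormal_columns (Γ 0)
    exact ⟨_, rfl, W, Z, hW1, hZ⟩
  rw [hr] at hrank
  have hcont : ContinuousAt Γ 0 :=
    continuousAt_pi.2 fun i => continuousAt_pi.2 fun j => (hΓ i j).continuousAt
  obtain ⟨S, hS⟩ : ∃ S : ℝ → Matrix (Fin r) (Fin r) ℝ, S = fun t => Wᵀ * Γ t * Z := ⟨_, rfl⟩
  have hS0 : S 0 = 1 := by
    rw [hS]; simp only; rw [Matrix.mul_assoc, ← hZ, hW1]
  have hSc : ContinuousAt S 0 := by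
    have : Continuous fun M : Matrix a b ℝ => Wᵀ * M * Z := by fun_prop
    rw [hS]
    exact this.continuousAt.comp hcont
  have hdet : ContinuousAt (fun t => (S t).det) 0 := by
    have : Continuous fun M : Matrix (Fin r) (Fin r) ℝ => M.det := by fun_prop
    exact this.continuousAt.comp hSc
  have hdet0 : (S 0).det ≠ 0 := by rw [hS0, det_one]; exact one_ne_zero
  have hinv : ContinuousAt (fun t => (S t)⁻¹) 0 := by
    have e : (fun t => (S t)⁻¹) = fun t => (S t).det⁻¹ • (S t).adjugate := by
      funext t; rw [inv_def, Ring.inverse_eq_inv']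
    rw [e]
    have : Continuous fun M : Matrix (Fin r) (Fin r) ℝ => M.adjugate := by
      fun_prop
    exact (hdet.inv₀ hdet0).smul (this.continuousAt.comp hSc)
  -- A kernel vector of `Γ 0` is carried along to kernel vectors of `Γ t` for small `t`. Continuity
  -- at `0` suffices.
  obtain ⟨ξ, hξ⟩ : ∃ ξ : ℝ → b → ℝ, ξ = fun t => x - Z *ᵥ ((S t)⁻¹ *ᵥ ((Wᵀ * Γ t) *ᵥ x)) :=
    ⟨_, rfl⟩
  have hξc : Tendsto ξ (𝓝 0) (𝓝 x) := by
    have h1 : Tendsto (fun t => (Wᵀ * Γ t) *ᵥ x) (𝓝 0) (𝓝 ((Wᵀ * Γ 0) *ᵥ x)) := by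
      have : Continuous fun M : Matrix a b ℝ => (Wᵀ * M) *ᵥ x := by fun_prop
      exact (this.tendsto (Γ 0)).comp hcont
    have h2 : Tendsto (fun t => Z *ᵥ ((S t)⁻¹ *ᵥ ((Wᵀ * Γ t) *ᵥ x))) (𝓝 0)
        (𝓝 (Z *ᵥ ((S 0)⁻¹ *ᵥ ((Wᵀ * Γ 0) *ᵥ x)))) :=
      tendsto_mulVec tendsto_const_nhds (tendsto_mulVec hinv h1)
    have h3 := (tendsto_const_nhds (x := x)).sub h2
    rw [← mulVec_mulVec, hx, mulVec_zero, mulVec_zero, mulVec_zero, sub_zero] at h3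
    rw [hξ]
    exact h3
  have hker : ∀ᶠ t in 𝓝 (0 : ℝ), Γ t *ᵥ ξ t = 0 := by
    filter_upwards [hrank, hdet.eventually_ne hdet0] with t h1 h2
    subst hS hξ
    exact mulVec_sub_eq_zero_of_rank_le h1 Wᵀ Z (isUnit_iff_ne_zero.2 h2) x
  set D : ℝ → Matrix a b ℝ := fun t => t⁻¹ • (Γ t - Γ 0) with hD
  have hDlim : Tendsto D (𝓝[≠] 0) (𝓝 Γ') := by
    refine tendsto_pi_nhds.2 fun i => tendsto_pi_nhds.2 fun j => ?_
    refine (hasDerivAt_iff_tendsto_slope.1 (hΓ i j)).congr fun t => ?_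
    simp [slope, hD]
  have hlim : Tendsto (fun t => y ⬝ᵥ D t *ᵥ ξ t) (𝓝[≠] 0) (𝓝 (y ⬝ᵥ Γ' *ᵥ x)) := by
    have h2 : Tendsto ξ (𝓝[≠] 0) (𝓝 x) := hξc.mono_left nhdsWithin_le_nhds
    exact tendsto_finsetSum _ fun i _ =>
      (tendsto_pi_nhds.1 (tendsto_mulVec hDlim h2) i).const_mul (y i)
  -- In the difference quotient, `Γ t` annihilates `ξ t` and `y` annihilates `Γ 0`.
  have hzero : ∀ᶠ t in 𝓝[≠] (0 : ℝ), y ⬝ᵥ D t *ᵥ ξ t = 0 := by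
    filter_upwards [nhdsWithin_le_nhds hker] with t ht
    rw [hD]
    simp only
    rw [smul_mulVec, sub_mulVec, ht, zero_sub, dotProduct_smul, dotProduct_neg, dotProduct_mulVec,
      hy]
    simp
  exact tendsto_nhds_unique (hlim.congr' hzero) tendsto_const_nhds

end Tangent

/-! ### The operator `𝒬` and the condition on tangent vectors -/

section ModeProduct

variable {d : ℕ} {n m : Fin d → ℕ} (Q : (k : Fin d) → Matrix (Fin (n k)) (Fin (m k)) ℝ)

theorem modeProduct_apply (X : Tensor m) (i : Idx n) :
    modeProduct Q X i = ∑ j, (∏ k, Q k (i k) (j k)) * X j := by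
  simp [modeProduct, toLpLin_apply, mulVec, dotProduct]

theorem unfolding_modeProduct (k : ℕ) (X : Tensor m) :
    unfolding k (modeProduct Q X)
      = (of fun (a : (j : {j : Fin d // (j : ℕ) < k}) → Fin (n j))
            (b : (j : {j : Fin d // (j : ℕ) < k}) → Fin (m j)) =>
            ∏ l : {j : Fin d // (j : ℕ) < k}, Q l (a l) (b l) : Matrix _ _ ℝ)
        * unfolding k X
        * (of fun (a : (j : {j : Fin d // ¬ (j : ℕ) < k}) → Fin (n j))
            (b : (j : {j : Fin d // ¬ (j : ℕ) < k}) → Fin (m j)) =>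
            ∏ l : {j : Fin d // ¬ (j : ℕ) < k}, Q l (a l) (b l) : Matrix _ _ ℝ)ᵀ := by
  ext a b
  obtain ⟨h, hh⟩ := (Equiv.piEquivPiSubtypeProd (fun j : Fin d => (j : ℕ) < k)
    fun j => Fin (n j)).surjective (a, b)
  have ha : a = restr _ h := (congrArg Prod.fst hh).symm
  have hb : b = restr _ h := (congrArg Prod.snd hh).symm
  subst ha hb
  rw [unfolding_restr, modeProduct_apply, Matrix.mul_assoc, mul_apply,
    ← (Equiv.piEquivPiSubtypeProd (fun j : Fin d => (j : ℕ) < k) fun j => Fin (m j)).symm.sum_comp,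
    Fintype.sum_prod_type]
  refine Finset.sum_congr rfl fun a _ => ?_
  rw [mul_apply, Finset.mul_sum]
  refine Finset.sum_congr rfl fun b _ => ?_
  rw [← Fintype.prod_subtype_mul_prod_subtype (fun j : Fin d => (j : ℕ) < k)]
  have e1 : ∀ l : {j : Fin d // (j : ℕ) < k},
      (Equiv.piEquivPiSubtypeProd (fun j : Fin d => (j : ℕ) < k) fun j => Fin (m j)).symm
        (a, b) l = a l := fun l => by
    simp [Equiv.piEquivPiSubtypeProd, l.2]
  have e2 : ∀ l : {j : Fin d // ¬ (j : ℕ) < k},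
      (Equiv.piEquivPiSubtypeProd (fun j : Fin d => (j : ℕ) < k) fun j => Fin (m j)).symm
        (a, b) l = b l := fun l => by
    simp [Equiv.piEquivPiSubtypeProd, l.2]
  simp only [e1, e2, of_apply, transpose_apply, unfolding]
  simp only [restr]
  ring

theorem rank_unfolding_modeProduct_le (k : ℕ) (X : Tensor m) :
    (unfolding k (modeProduct Q X)).rank ≤ (unfolding k X).rank := by
  rw [unfolding_modeProduct]
  exact (rank_mul_le_left _ _).trans (rank_mul_le_right _ _)

theorem sum_singleton_mode {p : Fin d → Prop} [DecidablePred p] {k : Fin d} (hk : p k)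
    (hp : ∀ j, p j → j = k) (F : ((j : {j // p j}) → Fin (n j)) → ℝ) :
    ∑ a, F a = ∑ c : Fin (n k), F fun j => Fin.cast (by rw [hp j j.2]) c := by
  refine Finset.sum_bij' (fun a _ => a ⟨k, hk⟩) (fun c _ j => Fin.cast (by rw [hp j j.2]) c)
    (by simp) (by simp) ?_ ?_ ?_
  · rintro a -
    funext ⟨j, hj⟩
    obtain rfl := hp j hj
    rfl
  · rintro c -
    rfl
  · rintro a -
    congr 1
    funext ⟨j, hj⟩
    obtain rfl := hp j hj
    rfl

theorem singleton_mode_mul {p : Fin d → Prop} [DecidablePred p] {k : Fin d} (hk : p k)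
    (hp : ∀ j, p j → j = k) (M N : Matrix (Fin (n k)) (Fin (n k)) ℝ) :
    (of fun (a b : (j : {j // p j}) → Fin (n j)) => M (a ⟨k, hk⟩) (b ⟨k, hk⟩))
      * (of fun (a b : (j : {j // p j}) → Fin (n j)) => N (a ⟨k, hk⟩) (b ⟨k, hk⟩))
      = of fun a b => (M * N) (a ⟨k, hk⟩) (b ⟨k, hk⟩) := by
  ext a b
  rw [mul_apply, sum_singleton_mode hk hp, of_apply, mul_apply]
  rfl

/-- The orthogonal projection `Q_k Q_kᵀ` acting on the mode `k`. -/
def modeProjection (k : Fin d) : Matrix (Idx n) (Idx n) ℝ :=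
  lift (fun j => j = k) (of fun a b => (Q k * (Q k)ᵀ) (a ⟨k, rfl⟩) (b ⟨k, rfl⟩))

variable {Q}

theorem modeProjection_mulVec_modeProduct (hQ : ∀ k, (Q k)ᵀ * Q k = 1) (k : Fin d)
    (X : Tensor m) : modeProjection Q k *ᵥ (modeProduct Q X).ofLp = (modeProduct Q X).ofLp := by
  funext h
  rw [modeProjection, lift_mulVec]
  simp only [modeProduct_apply, of_apply, Finset.mul_sum]
  rw [Finset.sum_comm]
  refine Finset.sum_congr rfl fun j _ => ?_
  rw [sum_singleton_mode (p := fun j => j = k) rfl fun _ hj => hj]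
  have e : ∀ c : Fin (n k), ∏ l, Q l (glue (fun j => j = k)
      (fun j => Fin.cast (by rw [j.2]) c) h l) (j l)
      = Q k c (j k) * ∏ l ∈ Finset.univ.erase k, Q l (h l) (j l) := by
    intro c
    rw [← Finset.mul_prod_erase _ _ (Finset.mem_univ k), glue_apply_of_pos (p := fun j => j = k) rfl]
    congr 1
    refine Finset.prod_congr rfl fun l hl => ?_
    rw [glue_apply_of_not (p := fun j => j = k) (Finset.ne_of_mem_erase hl)]
  have e2 : ∑ c : Fin (n k), (Q k * (Q k)ᵀ) (h k) c * Q k c (j k) = Q k (h k) (j k) := by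
    rw [← mul_apply, Matrix.mul_assoc, hQ, Matrix.mul_one]
  rw [← Finset.mul_prod_erase _ _ (Finset.mem_univ k), ← e2, Finset.sum_mul, Finset.sum_mul]
  refine Finset.sum_congr rfl fun c _ => ?_
  rw [e]
  simp only [restr, Fin.cast_eq_self]
  ring

theorem modeProjection_transpose (k : Fin d) : (modeProjection Q k)ᵀ = modeProjection Q k := by
  rw [modeProjection, lift_transpose]
  congr 1
  ext a b
  simp only [transpose_apply, of_apply, mul_apply, mul_comm]

theorem modeProjection_mul_self (hQ : ∀ k, (Q k)ᵀ * Q k = 1) (k : Fin d) :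
    modeProjection Q k * modeProjection Q k = modeProjection Q k := by
  have h : (Q k * (Q k)ᵀ) * (Q k * (Q k)ᵀ) = Q k * (Q k)ᵀ := by
    rw [Matrix.mul_assoc, ← Matrix.mul_assoc (Q k)ᵀ, hQ, Matrix.one_mul]
  have h2 := singleton_mode_mul (p := fun j => j = k) rfl (fun _ hj => hj) (Q k * (Q k)ᵀ)
    (Q k * (Q k)ᵀ)
  rw [h] at h2
  exact (lift_mul _ _).symm.trans (congrArg (lift _) h2)

theorem adjoint_modeProduct_comp (hQ : ∀ k, (Q k)ᵀ * Q k = 1) :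
    ContinuousLinearMap.adjoint (modeProduct Q) ∘L modeProduct Q = ContinuousLinearMap.id ℝ _ := by
  have hM : (of fun (i : Idx n) (j : Idx m) => ∏ k, Q k (i k) (j k))ᵀ
      * (of fun (i : Idx n) (j : Idx m) => ∏ k, Q k (i k) (j k)) = 1 := by
    ext j j'
    simp only [mul_apply, transpose_apply, of_apply, ← Finset.prod_mul_distrib]
    rw [← Fintype.piFinset_univ, ← Finset.prod_univ_sum (fun _ => Finset.univ)
      fun k i => Q k i (j k) * Q k i (j' k)]
    have : ∀ k, ∑ i, Q k i (j k) * Q k i (j' k) = if j k = j' k then 1 else 0 := fun k => by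
      have := congrFun (congrFun (hQ k) (j k)) (j' k)
      rwa [mul_apply, one_apply] at this
    simp only [this, one_apply, Finset.prod_ite_zero, Finset.prod_const_one, funext_iff,
      Finset.mem_univ, true_imp_iff]
  refine ContinuousLinearMap.ext fun x => ext_inner_right ℝ fun y => ?_
  rw [ContinuousLinearMap.comp_apply, ContinuousLinearMap.adjoint_inner_left,
    ContinuousLinearMap.id_apply, EuclideanSpace.inner_eq_star_dotProduct,
    EuclideanSpace.inner_eq_star_dotProduct]
  simp only [modeProduct, LinearMap.coe_toContinuousLinearMap', toLpLin_apply, star_trivial]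
  rw [dotProduct_mulVec, vecMul_mulVec, hM, vecMul_one]

theorem norm_modeProduct (hQ : ∀ k, (Q k)ᵀ * Q k = 1) (X : Tensor m) :
    ‖modeProduct Q X‖ = ‖X‖ := by
  have h := congrArg (fun T => inner ℝ (T X) X) (adjoint_modeProduct_comp hQ)
  simp only [ContinuousLinearMap.comp_apply, ContinuousLinearMap.adjoint_inner_left,
    ContinuousLinearMap.id_apply, real_inner_self_eq_norm_sq] at h
  exact (sq_eq_sq₀ (norm_nonneg _) (norm_nonneg _)).1 h

/-- A curve of TT-rank `r` through `B` is pushed forward by `𝒬`, which does not increase unfolding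
ranks. The columns of `(1 - R)ᵀ` lie in the kernel of the unfolding of `A`, and the rows of `1 - L`
in its left kernel, so the velocity vanishes between them. -/
theorem complement_mulVec_of_mem_tangentSpaceAt {r : Fin (d + 1) → ℕ} {B : Tensor m}
    (hr : ttRank (modeProduct Q B) = r) {k : Fin (d + 1)} (h0 : k ≠ 0) (hl : k ≠ Fin.last d)
    {L R} (hL : lift (fun j : Fin d => (j : ℕ) < k) L *ᵥ (modeProduct Q B).ofLp
      = (modeProduct Q B).ofLp)
    (hR : lift (fun j : Fin d => ¬ (j : ℕ) < k) R *ᵥ (modeProduct Q B).ofLp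
      = (modeProduct Q B).ofLp)
    {v : Tensor m} (hv : v ∈ tangentSpaceAt (ttManifold m r) B) :
    (1 - lift (fun j : Fin d => (j : ℕ) < k) L) *ᵥ
      ((1 - lift (fun j : Fin d => ¬ (j : ℕ) < k) R) *ᵥ (modeProduct Q v).ofLp) = 0 := by
  rw [tangentSpaceAt] at hv
  induction hv using Submodule.span_induction with
  | zero => simp
  | add x y _ _ hx hy => simp [mulVec_add, hx, hy]
  | smul c x _ hx => simp [mulVec_smul, hx]
  | mem v hv =>
    obtain ⟨γ, hγ, hγ0, hγM, rfl⟩ := hv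
    have hd : HasDerivAt γ (deriv γ 0) 0 :=
      (hγ.differentiableAt (by simp)).hasDerivAt
    have hd' : HasDerivAt (fun t => modeProduct Q (γ t)) (modeProduct Q (deriv γ 0)) 0 :=
      (modeProduct Q).hasFDerivAt.comp_hasDerivAt _ hd
    have hunf : ∀ a b, HasDerivAt (fun t => unfolding k (modeProduct Q (γ t)) a b)
        (unfolding k (modeProduct Q (deriv γ 0)) a b) 0 := by
      intro a b
      exact (EuclideanSpace.proj ((Equiv.piEquivPiSubtypeProd (fun j : Fin d => (j : ℕ) < k)
        fun j => Fin (n j)).symm (a, b)) : Tensor n →L[ℝ] ℝ).hasFDerivAt.comp_hasDerivAt _ hd'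
    have hrank : ∀ᶠ t in 𝓝 (0 : ℝ), (unfolding k (modeProduct Q (γ t))).rank
        ≤ (unfolding k (modeProduct Q (γ 0))).rank := by
      filter_upwards [hγM] with t ht
      refine (rank_unfolding_modeProduct_le Q k (γ t)).trans (le_of_eq ?_)
      rw [hγ0, ← ttRank_of_ne _ h0 hl, ← ttRank_of_ne _ h0 hl, hr]
      exact congrFun ht k
    have key := fun x y => dotProduct_deriv_mulVec_eq_zero hunf hrank (x := x) (y := y)
    simp only [hγ0] at key
    have hL' : (1 - L) * unfolding k (modeProduct Q B) = 0 := by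
      rw [Matrix.sub_mul, Matrix.one_mul, ← unfolding_lift_left, hL, sub_self]
    have hR' : unfolding k (modeProduct Q B) * (1 - R)ᵀ = 0 := by
      rw [transpose_sub, transpose_one, Matrix.mul_sub, Matrix.mul_one, ← unfolding_lift_right, hR,
        sub_self]
    have hzero : (1 - L) * (unfolding k (modeProduct Q (deriv γ 0)) * (1 - R)ᵀ) = 0 := by
      ext a b
      have := key (fun j => (1 - R)ᵀ j b) ((1 - L) a)
        (funext fun i => congrFun (congrFun hR' i) b) (funext fun j => congrFun (congrFun hL' a) j)
      exact this
    have e1 : 1 - lift (fun j : Fin d => (j : ℕ) < k) L = lift _ (1 - L) := by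
      rw [lift_sub, lift_one]
    have e2 : 1 - lift (fun j : Fin d => ¬ (j : ℕ) < k) R = lift _ (1 - R) := by
      rw [lift_sub, lift_one]
    rw [e1, e2]
    have hfin := unfolding_lift_left k (1 - L) (WithLp.toLp 2
      (lift (fun j : Fin d => ¬ (j : ℕ) < k) (1 - R) *ᵥ (modeProduct Q (deriv γ 0)).ofLp) :
        Tensor n)
    rw [unfolding_lift_right, hzero] at hfin
    have h0' : unfolding k (0 : Tensor n) = 0 := rfl
    exact congrArg WithLp.ofLp (unfolding_injective k (hfin.trans h0'.symm))

end ModeProduct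

end TensorTrain

/-! ### Pointwise bounds from nested projections -/

namespace TensorTrain

open Matrix

section Projections

variable {ι : Type*} [Fintype ι]

/-- Cauchy–Schwarz: `F ξ ξ` is the squared norm of row `ξ` of `F`. -/
theorem sq_apply_le_of_mulVec_eq {F : Matrix ι ι ℝ} (hF : F * Fᵀ = F) {w : ι → ℝ}
    (hw : F *ᵥ w = w) (ξ : ι) : w ξ ^ 2 ≤ (w ⬝ᵥ w) * F ξ ξ := by
  have h1 : F ξ ξ = ∑ j, F ξ j ^ 2 := by
    conv_lhs => rw [← hF, mul_apply]
    exact Finset.sum_congr rfl fun j _ => by rw [transpose_apply, pow_two]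
  have h2 : w ξ = ∑ j, F ξ j * w j := (congrFun hw ξ).symm
  rw [h2, h1]
  refine (Finset.sum_mul_sq_le_sq_mul_sq _ _ _).trans (le_of_eq ?_)
  rw [mul_comm, dotProduct]
  congr 1
  exact Finset.sum_congr rfl fun j _ => pow_two _

variable [DecidableEq ι]

/-- A pointwise bound for the vectors in the range of `∑ₖ (Pₖ - Pₖ₊₁) Rₖ Sₖ`, where the `Pₖ` are
nested orthogonal projections. -/
theorem sq_apply_le_of_nested_projections {d : ℕ} {P : Fin (d + 1) → Matrix ι ι ℝ}
    {R S : Fin d → Matrix ι ι ℝ} (hP0 : P 0 = 1) (hPl : P (Fin.last d) = 0)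
    (hPt : ∀ k, (P k)ᵀ = P k) (hPP : ∀ k, P k * P k = P k)
    (hnest : ∀ k : Fin d, P k.castSucc * P k.succ = P k.succ)
    (hRt : ∀ k, (R k)ᵀ = R k) (hRR : ∀ k, R k * R k = R k)
    (hSt : ∀ k, (S k)ᵀ = S k) (hSS : ∀ k, S k * S k = S k)
    (hPR : ∀ k : Fin d, P k.castSucc * R k = R k * P k.castSucc)
    (hPR' : ∀ k : Fin d, P k.succ * R k = R k * P k.succ)
    (hPS : ∀ k : Fin d, P k.castSucc * S k = S k * P k.castSucc)
    (hPS' : ∀ k : Fin d, P k.succ * S k = S k * P k.succ)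
    (hRS : ∀ k, R k * S k = S k * R k) {u : ι → ℝ}
    (hu : ∀ k : Fin d, (1 - P k.succ) *ᵥ ((1 - R k) *ᵥ u) = 0) (hSu : ∀ k, S k *ᵥ u = u)
    (ξ : ι) : u ξ ^ 2 ≤ (u ⬝ᵥ u) * ∑ k : Fin d, (P k.castSucc * R k * S k) ξ ξ := by
  have hnest' : ∀ k : Fin d, P k.succ * P k.castSucc = P k.succ := fun k => by
    have := congrArg transpose (hnest k)
    rwa [transpose_mul, hPt, hPt] at this
  have htel : ∀ f : Fin (d + 1) → ℝ, ∑ k : Fin d, (f k.castSucc - f k.succ)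
      = f 0 - f (Fin.last d) := fun f => by
    have h1 := Fin.sum_univ_castSucc f
    have h2 := Fin.sum_univ_succ f
    rw [Finset.sum_sub_distrib]
    linarith
  -- By nestedness the `D k` are orthogonal projections; telescoping shows that the pieces `D k *ᵥ
  -- u` sum to `u` and their squared norms to that of `u`.
  set D : Fin d → Matrix ι ι ℝ := fun k => P k.castSucc - P k.succ with hD
  have hsum : ∑ k, (D k *ᵥ u) ξ = u ξ := by
    have := htel fun k => (P k *ᵥ u) ξ
    rw [hP0, hPl, one_mulVec, zero_mulVec, Pi.zero_apply, sub_zero] at this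
    rw [← this]
    exact Finset.sum_congr rfl fun k _ => by rw [hD]; simp only; rw [sub_mulVec]; rfl
  have hDD : ∀ k, (D k)ᵀ * D k = D k := fun k => by
    simp only [hD, transpose_sub, hPt, Matrix.sub_mul, Matrix.mul_sub, hPP, hnest, hnest']
    abel
  have hnorm : ∑ k, (D k *ᵥ u) ⬝ᵥ (D k *ᵥ u) = u ⬝ᵥ u := by
    have := htel fun k => u ⬝ᵥ (P k *ᵥ u)
    rw [hP0, hPl, one_mulVec, zero_mulVec, dotProduct_zero, sub_zero] at this
    rw [← this]
    refine Finset.sum_congr rfl fun k _ => ?_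
    rw [dotProduct_mulVec, vecMul_mulVec, hDD, ← dotProduct_mulVec, hD]
    simp only
    rw [sub_mulVec, dotProduct_sub]
  have hF : ∀ k : Fin d, (P k.castSucc * R k * S k) * (P k.castSucc * R k * S k)ᵀ
      = P k.castSucc * R k * S k := fun k => by
    have ht : (P k.castSucc * R k * S k)ᵀ = P k.castSucc * R k * S k := by
      rw [transpose_mul, transpose_mul, hPt, hRt, hSt, ← hPR, ← Matrix.mul_assoc, ← hPS,
        Matrix.mul_assoc, ← hRS, Matrix.mul_assoc]
    rw [ht]
    calc P k.castSucc * R k * S k * (P k.castSucc * R k * S k)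
        = P k.castSucc * R k * (S k * P k.castSucc) * R k * S k := by
          simp only [Matrix.mul_assoc]
      _ = P k.castSucc * (R k * P k.castSucc) * (S k * R k) * S k := by
          rw [← hPS]; simp only [Matrix.mul_assoc]
      _ = (P k.castSucc * P k.castSucc) * (R k * R k) * (S k * S k) := by
          rw [← hPR, ← hRS]; simp only [Matrix.mul_assoc]
      _ = _ := by rw [hPP, hRR, hSS]
  -- As `D k` absorbs `1 - P k.succ`, the hypothesis `hu` gives `D k (1 - R k) u = 0`. All factors
  -- commute with `D k`.
  have hfix : ∀ k, (P k.castSucc * R k * S k) *ᵥ (D k *ᵥ u) = D k *ᵥ u := fun k => by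
    have h1 : P k.castSucc * D k = D k := by
      simp only [hD, Matrix.mul_sub, hPP, hnest]
    have h2 : R k * D k = D k * R k := by
      simp only [hD, Matrix.mul_sub, Matrix.sub_mul, hPR, hPR']
    have h3 : S k * D k = D k * S k := by
      simp only [hD, Matrix.mul_sub, Matrix.sub_mul, hPS, hPS']
    have h4 : D k * (1 - P k.succ) = D k := by
      simp only [hD, Matrix.mul_sub, Matrix.sub_mul, Matrix.mul_one, hPP, hnest]
      abel
    have h5 : D k *ᵥ (R k *ᵥ u) = D k *ᵥ u := by
      have := congrArg (D k *ᵥ ·) (hu k)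
      rw [mulVec_mulVec, h4, mulVec_zero, sub_mulVec 1 (R k), one_mulVec, mulVec_sub, sub_eq_zero] at this
      exact this.symm
    rw [← mulVec_mulVec, mulVec_mulVec _ (S k), h3, ← mulVec_mulVec _ (D k), hSu, ← mulVec_mulVec,
      mulVec_mulVec _ (R k), h2, ← mulVec_mulVec _ (D k), h5, mulVec_mulVec, h1]
  rw [← hsum, ← hnorm]
  refine Finset.sum_sq_le_sum_mul_sum_of_sq_le_mul _ (fun k _ => Finset.sum_nonneg fun _ _ => mul_self_nonneg _)
    (fun k _ => ?_) fun k _ => sq_apply_le_of_mulVec_eq (hF k) (hfix k) ξ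
  rw [← hF k, mul_apply]
  exact Finset.sum_nonneg fun j _ => mul_self_nonneg _

end Projections

/-! ### The entrywise bound on images of tangent vectors -/

section KeyBound

variable {d : ℕ} {n m : Fin d → ℕ} {Q : (k : Fin d) → Matrix (Fin (n k)) (Fin (m k)) ℝ}

theorem gram_mul_self {a : Type*} [Fintype a] [DecidableEq a] {r : ℕ} {W : Matrix a (Fin r) ℝ}
    (hW : Wᵀ * W = 1) : (W * Wᵀ) * (W * Wᵀ) = W * Wᵀ := by
  rw [Matrix.mul_assoc, ← Matrix.mul_assoc Wᵀ, hW, Matrix.one_mul]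

theorem gram_apply_self {a : Type*} [Fintype a] {r : ℕ} (W : Matrix a (Fin r) ℝ) (i : a) :
    (W * Wᵀ) i i = ∑ α, W i α ^ 2 := by
  rw [mul_apply]
  exact Finset.sum_congr rfl fun α _ => by rw [transpose_apply, pow_two]

theorem gram_diag_le_of_coherence_le {n m : ℕ} {Q : Matrix (Fin n) (Fin m) ℝ} {μ : ℝ}
    (hm : 0 < m) (hQ : coherence Q ≤ μ) (i : Fin n) : (Q * Qᵀ) i i ≤ μ * m / n := by
  have hn : (0 : ℝ) < n := by exact_mod_cast i.pos
  have hm' : (0 : ℝ) < m := by exact_mod_cast hm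
  have h1 : ‖(WithLp.toLp 2 (Q i) : EuclideanSpace ℝ (Fin m))‖ ^ 2
      ≤ ⨆ i, ‖(WithLp.toLp 2 (Q i) : EuclideanSpace ℝ (Fin m))‖ ^ 2 :=
    le_ciSup (f := fun i => ‖(WithLp.toLp 2 (Q i) : EuclideanSpace ℝ (Fin m))‖ ^ 2)
      (Set.finite_range _).bddAbove i
  rw [gram_apply_self]
  rw [EuclideanSpace.norm_sq_eq] at h1
  rw [coherence, div_mul_eq_mul_div, div_le_iff₀ hm'] at hQ
  rw [le_div_iff₀ hn]
  have h2 : ∑ α, Q i α ^ 2 ≤ ⨆ i, ‖(WithLp.toLp 2 (Q i) : EuclideanSpace ℝ (Fin m))‖ ^ 2 := by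
    simpa using h1
  nlinarith

theorem coherence_nonneg {n m : ℕ} (Q : Matrix (Fin n) (Fin m) ℝ) : 0 ≤ coherence Q :=
  mul_nonneg (by positivity) (Real.iSup_nonneg fun i => sq_nonneg _)

theorem sq_modeProduct_apply_le (hd : 2 ≤ d) (hn : ∀ k, 0 < n k) (hm : ∀ k, 0 < m k)
    (hQ : ∀ k, (Q k)ᵀ * Q k = 1) {B : Tensor m} (hr : ∀ k, 0 < ttRank (modeProduct Q B) k)
    {μ₁ μ₂ : ℝ} (hμ₁ : coreCoherence (modeProduct Q B) ≤ μ₁) (hμ₂ : ∀ k, coherence (Q k) ≤ μ₂)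
    {v : Tensor m} (hv : v ∈ tangentSpaceAt (ttManifold m (ttRank (modeProduct Q B))) B)
    (ξ : Idx n) :
    (modeProduct Q v ξ) ^ 2 ≤ sideConst n m (ttRank (modeProduct Q B)) μ₁ μ₂ * ‖v‖ ^ 2 := by
  have : Nonempty (Idx n) := ⟨ξ⟩
  set A := modeProduct Q B with hA
  have hd0 : 0 < d := by omega
  obtain ⟨U, W, hU, hUA, hW, hWs, hW0, hWU⟩ := exists_leftOrthogonal hd0 A
  obtain ⟨V, Y, hV, hVA, hY, hYl, hYV⟩ := exists_rightOrthogonal hd0 A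
  have hμ₁0 : 0 ≤ μ₁ := (coreCoherence_nonneg A).trans hμ₁
  have hμ₂0 : 0 ≤ μ₂ := (coherence_nonneg _).trans (hμ₂ ⟨0, hd0⟩)
  -- The last interface is `A` itself, not orthonormal; setting the last projection to `0` makes the
  -- telescoping sum end correctly.
  set P : Fin (d + 1) → Matrix (Idx n) (Idx n) ℝ := fun k =>
    if k = Fin.last d then 0 else lift (fun j : Fin d => (j : ℕ) < k) (W k * (W k)ᵀ) with hP
  set R : Fin d → Matrix (Idx n) (Idx n) ℝ := fun k =>
    lift (fun j : Fin d => ¬ (j : ℕ) < (k.succ : Fin (d + 1))) (Y k.succ * (Y k.succ)ᵀ) with hR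
  have hne : ∀ k : Fin d, k.castSucc ≠ Fin.last d := fun k => (Fin.castSucc_lt_last k).ne
  have h0l : (0 : Fin (d + 1)) ≠ Fin.last d := by
    rw [Ne, Fin.ext_iff, Fin.val_zero, Fin.val_last]; omega
  have hPk : ∀ {k : Fin (d + 1)}, k ≠ Fin.last d →
      P k = lift (fun j : Fin d => (j : ℕ) < k) (W k * (W k)ᵀ) := fun hk => if_neg hk
  have hPl : P (Fin.last d) = 0 := if_pos rfl
  have hgramt : ∀ {a : Type} [Fintype a] {r : ℕ} (W : Matrix a (Fin r) ℝ),
      (W * Wᵀ)ᵀ = W * Wᵀ := fun W => by rw [transpose_mul, transpose_transpose]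
  have hP0 : P 0 = 1 := by
    have : IsEmpty {j : Fin d // (j : ℕ) < (0 : Fin (d + 1))} := ⟨fun j => by simpa using j.2⟩
    rw [hPk h0l, (const_gram (ttRank_zero A) hW0).2, lift_one]
  have hPt : ∀ k, (P k)ᵀ = P k := fun k => by
    by_cases hk : k = Fin.last d
    · rw [hk, hPl, transpose_zero]
    · rw [hPk hk, lift_transpose, hgramt]
  have hSfix : ∀ k, modeProjection Q k *ᵥ A.ofLp = A.ofLp := fun k =>
    modeProjection_mulVec_modeProduct hQ k B
  -- Both factors act on mode `k`, so their commutation is not automatic. It holds because the mode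
  -- projection fixes `A`, hence its slices and the left interface.
  have hSP : ∀ k : Fin d, modeProjection Q k * P k.succ = P k.succ := fun k => by
    by_cases hk : k.succ = Fin.last d
    · rw [hk, hPl, Matrix.mul_zero]
    · rw [hPk hk]
      refine lift_mul_lift_gram (fun l hl => ?_) fun β =>
        lift_mulVec_of_mem_slices (fun l hl => ?_) (hSfix k) (hWs _ (Fin.succ_ne_zero k) β) <;>
      · rw [hl, Fin.val_succ]; omega
  have key := sq_apply_le_of_nested_projections (P := P) (R := R) (S := modeProjection Q) hP0 hPl
    hPt ?_ ?_ ?_ ?_ modeProjection_transpose (modeProjection_mul_self hQ) ?_ ?_ ?_ ?_ ?_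
    (u := (modeProduct Q v).ofLp) ?_ (fun k => modeProjection_mulVec_modeProduct hQ k v) ξ
  · have hnorm : (modeProduct Q v).ofLp ⬝ᵥ (modeProduct Q v).ofLp = ‖v‖ ^ 2 := by
      rw [← norm_modeProduct hQ v, EuclideanSpace.norm_sq_eq, dotProduct]
      exact Finset.sum_congr rfl fun i _ => by rw [Real.norm_eq_abs, sq_abs, pow_two]
    rw [hnorm] at key
    refine key.trans ?_
    rw [mul_comm]
    refine mul_le_mul_of_nonneg_right ?_ (sq_nonneg _)
    rw [sideConst, Finset.mul_sum]
    refine Finset.sum_le_sum fun k _ => ?_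
    rw [hPk (hne k), hR]
    simp only [modeProjection]
    have d1 : ∀ l : Fin d, (l : ℕ) < (k.castSucc : Fin (d + 1)) →
        ¬ ¬ (l : ℕ) < (k.succ : Fin (d + 1)) := fun l h1 h2 => h2 (by
      rw [Fin.val_castSucc] at h1; rw [Fin.val_succ]; omega)
    have d2 : ∀ l : Fin d, (l : ℕ) < (k.castSucc : Fin (d + 1)) → ¬ l = k := fun l h1 h2 => by
      rw [h2, Fin.val_castSucc] at h1; exact lt_irrefl _ h1
    have d3 : ∀ l : Fin d, ¬ (l : ℕ) < (k.succ : Fin (d + 1)) → ¬ l = k := fun l h1 h2 => h1 (by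
      rw [h2, Fin.val_succ]; omega)
    rw [lift_mul_lift_mul_lift_diag d1 d2 d3, gram_apply_self, gram_apply_self, of_apply]
    have b1 := sum_sq_forward_le hr (ttRank_zero A) hn hμ₁0 (fun k => U k (ξ k))
      (fun k hk => norm_sq_slice_le_of_leftCoherence_le (hr _) (hr _)
        ((leftCoherence_le_coreCoherence hU hUA hk).trans hμ₁) (ξ k))
      (fun k => W k (restr _ ξ)) (fun α => hW0 _ α) (fun k => hWU k ξ) k.castSucc
      (by rw [Fin.val_castSucc]; exact k.2)
    have b2 := sum_sq_backward_le hr (ttRank_last A) hn hμ₁0 (fun k => V k (ξ k))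
      (fun k hk => norm_sq_slice_le_of_rightCoherence_le (hr _) (hr _)
        ((rightCoherence_le_coreCoherence hV hVA hk).trans hμ₁) (ξ k))
      (fun k => Y k (restr _ ξ)) (fun α => hYl _ α) (fun k => hYV k ξ) k.succ
      (by rw [Fin.val_succ]; omega)
    have b3 := gram_diag_le_of_coherence_le (hm k) (hμ₂ k) (ξ k)
    have hp1 : 0 < ∏ j ∈ ({j : Fin d | (j : ℕ) < (k.castSucc : Fin (d + 1))} :
        Finset (Fin d)), (n j : ℝ) := Finset.prod_pos fun j _ => by exact_mod_cast hn j
    have hp2 : 0 < ∏ j ∈ ({j : Fin d | ¬ (j : ℕ) < (k.succ : Fin (d + 1))} :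
        Finset (Fin d)), (n j : ℝ) := Finset.prod_pos fun j _ => by exact_mod_cast hn j
    have hnk : (0 : ℝ) < n k := by exact_mod_cast hn k
    have hprod : ∏ j, (n j : ℝ)
        = (∏ j ∈ ({j : Fin d | (j : ℕ) < (k.castSucc : Fin (d + 1))} : Finset (Fin d)),
            (n j : ℝ)) * n k *
          ∏ j ∈ ({j : Fin d | ¬ (j : ℕ) < (k.succ : Fin (d + 1))} : Finset (Fin d)),
            (n j : ℝ) := by
      rw [← Finset.prod_filter_mul_prod_filter_not Finset.univ
        fun j : Fin d => (j : ℕ) < (k.succ : Fin (d + 1))]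
      congr 1
      have hset : ({j : Fin d | (j : ℕ) < (k.succ : Fin (d + 1))} : Finset (Fin d))
          = insert k ({j : Fin d | (j : ℕ) < (k.castSucc : Fin (d + 1))} :
            Finset (Fin d)) := by
        ext j
        simp [Fin.ext_iff]
        omega
      rw [hset, Finset.prod_insert (by simp), mul_comm]
    refine (mul_le_mul (mul_le_mul b1 b2 (Finset.sum_nonneg fun _ _ => sq_nonneg _)
      (by positivity)) b3 ?_ (by positivity)).trans (le_of_eq ?_)
    · rw [gram_apply_self]; exact Finset.sum_nonneg fun _ _ => sq_nonneg _
    · rw [hprod]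
      -- With modes numbered from `0`, there are `k` left cores and `d - k - 1` right cores; mode
      -- `k` itself contributes `μ₂`.
      have hpow : μ₁ ^ (d - 1) = μ₁ ^ ((k.castSucc : Fin (d + 1)) : ℕ)
          * μ₁ ^ (d - ((k.succ : Fin (d + 1)) : ℕ)) := by
        rw [← pow_add]
        congr 1
        rw [Fin.val_succ, Fin.val_castSucc]; omega
      rw [hpow]
      generalize μ₁ ^ ((k.castSucc : Fin (d + 1)) : ℕ) = x1
      generalize μ₁ ^ (d - ((k.succ : Fin (d + 1)) : ℕ)) = x2
      field_simp
  · intro k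
    by_cases hk : k = Fin.last d
    · rw [hk, hPl, Matrix.zero_mul]
    · rw [hPk hk, ← lift_mul, gram_mul_self (hW k hk).1]
  · intro k
    by_cases hk : k.succ = Fin.last d
    · rw [hk, hPl, Matrix.mul_zero]
    · rw [hPk hk, hPk (hne k)]
      refine lift_mul_lift_gram (fun l hl => ?_) fun β =>
        lift_mulVec_of_mem_slices (fun l hl => ?_) (hW _ (hne k)).2
          (hWs _ (Fin.succ_ne_zero k) β) <;>
      · rw [Fin.val_castSucc] at hl; rw [Fin.val_succ]; omega
  · intro k
    rw [hR]; simp only; rw [lift_transpose, hgramt]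
  · intro k
    rw [hR]; simp only; rw [← lift_mul, gram_mul_self (hY _ (Fin.succ_ne_zero k)).1]
  · intro k
    rw [hPk (hne k), hR]
    exact lift_commute (fun l h1 h2 => h2 (by
      rw [Fin.val_castSucc] at h1; rw [Fin.val_succ]; omega)) _ _
  · intro k
    by_cases hk : k.succ = Fin.last d
    · rw [hk, hPl, Matrix.mul_zero, Matrix.zero_mul]
    · rw [hPk hk, hR]
      exact lift_commute (fun l h1 h2 => h2 h1) _ _
  · intro k
    rw [hPk (hne k), modeProjection]
    exact lift_commute (fun l h1 h2 => by
      rw [h2, Fin.val_castSucc] at h1; exact lt_irrefl _ h1) _ _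
  · intro k
    rw [hSP]
    have := congrArg transpose (hSP k)
    rwa [transpose_mul, hPt, modeProjection_transpose] at this
  · intro k
    rw [hR, modeProjection]
    exact lift_commute (fun l h1 h2 => h1 (by rw [h2, Fin.val_succ]; omega)) _ _
  · intro k
    by_cases hk : k.succ = Fin.last d
    -- At the last mode no modes remain on the right, so the tangency condition is vacuous.
    · have : R k = 1 := by
        have hlt : ∀ l : Fin d, (l : ℕ) < (k.succ : Fin (d + 1)) := fun l => by
          have := congrArg Fin.val hk
          rw [Fin.val_succ, Fin.val_last] at this
          rw [Fin.val_succ]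
          omega
        have hemp : IsEmpty {j : Fin d // ¬ (j : ℕ) < (k.succ : Fin (d + 1))} :=
          ⟨fun j => j.2 (hlt j.1)⟩
        have hY1 : ∀ k', k' = Fin.last d → ∀ a α, Y k' a α = 1 := by
          rintro _ rfl
          exact hYl
        rw [hR]
        simp only
        rw [(const_gram (W := Y k.succ) (by rw [hk, ttRank_last]) (hY1 _ hk)).2, lift_one]
      rw [this, sub_self, zero_mulVec, mulVec_zero]
    · rw [hPk hk, hR]
      exact complement_mulVec_of_mem_tangentSpaceAt rfl (Fin.succ_ne_zero k) hk (hW _ hk).2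
        (hY _ (Fin.succ_ne_zero k)).2 hv

end KeyBound

end TensorTrain

/-! ### Bernstein's inequality for a sampled tight frame -/

section FrameBernstein

open Matrix InnerProductSpace
open scoped RealInnerProductSpace

variable {ι I : Type*} [Fintype ι] [DecidableEq ι] [Fintype I]

theorem Matrix.posSemidef_of_inner_toEuclideanCLM {M : Matrix ι ι ℝ} (hM : Mᵀ = M)
    (h : ∀ x : EuclideanSpace ℝ ι, 0 ≤ ⟪x, toEuclideanCLM (𝕜 := ℝ) M x⟫) : M.PosSemidef := by
  refine .of_dotProduct_mulVec_nonneg (by rwa [IsHermitian, conjTranspose_eq_transpose_of_trivial])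
    fun x => ?_
  have := h (WithLp.toLp 2 x)
  rwa [inner_toEuclideanCLM] at this

open scoped Matrix.Norms.L2Operator in
/-- The matrix Bernstein inequality for self-adjoint operators, as a count of samples. -/
theorem card_norm_sum_clm_ge_le (Y : I → EuclideanSpace ℝ ι →L[ℝ] EuclideanSpace ℝ ι)
    (hY : ∀ ξ, IsSelfAdjoint (Y ξ)) (h0 : ∑ ξ, Y ξ = 0)
    {R ε : ℝ} (hR : 0 < R) (hε0 : 0 < ε) (hε1 : ε ≤ 1)
    (hb1 : ∀ ξ x, ⟪x, Y ξ x⟫ ≤ R * ‖x‖ ^ 2) (hb2 : ∀ ξ x, -(R * ‖x‖ ^ 2) ≤ ⟪x, Y ξ x⟫)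
    (hv : ∀ x, ∑ ξ, ‖Y ξ x‖ ^ 2 ≤ Fintype.card I * R * ‖x‖ ^ 2) {K : ℕ} (hK : 0 < K) :
    (({Ω : Fin K → I | K * ε ≤ ‖∑ l, Y (Ω l)‖} : Finset _).card : ℝ)
      ≤ 2 * Fintype.card ι * (Fintype.card I : ℝ) ^ K *
        Real.exp (-(3 * K * ε ^ 2 / (8 * R))) := by
  set φ := toEuclideanCLM (n := ι) (𝕜 := ℝ)
  have hφ : ∀ ξ, φ (φ.symm (Y ξ)) = Y ξ := fun ξ => φ.apply_symm_apply _
  have hsymm : ∀ ξ, (φ.symm (Y ξ))ᵀ = φ.symm (Y ξ) := fun ξ => by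
    rw [← conjTranspose_eq_transpose_of_trivial, ← star_eq_conjTranspose]
    exact EquivLike.injective φ (by rw [map_star, hφ, hY ξ])
  have hone : ∀ (c : ℝ) (x : EuclideanSpace ℝ ι), ⟪x, φ (c • 1) x⟫ = c * ‖x‖ ^ 2 := fun c x => by
    rw [map_smul, map_one, _root_.smul_apply, one_apply_eq_self,
      real_inner_smul_right, real_inner_self_eq_norm_sq]
  have key := card_norm_sum_ge_le (fun ξ => φ.symm (Y ξ)) hsymm (by rw [← map_sum, h0, map_zero])
    hR hε0 hε1
    (fun ξ => posSemidef_of_inner_toEuclideanCLM (by simp [hsymm]) fun x => by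
      rw [map_sub, hφ, _root_.sub_apply, inner_sub_right, hone]
      linarith [hb1 ξ x])
    (fun ξ => posSemidef_of_inner_toEuclideanCLM (by simp [hsymm]) fun x => by
      rw [map_add, hφ, _root_.add_apply, inner_add_right, hone]
      linarith [hb2 ξ x])
    (posSemidef_of_inner_toEuclideanCLM (by simp [hsymm, transpose_sum]) fun x => by
      rw [map_sub, _root_.sub_apply, inner_sub_right, hone, map_sum,
        _root_.sum_apply, inner_sum, sub_nonneg]
      refine le_trans (Finset.sum_le_sum fun ξ _ => ?_) (hv x)
      rw [map_mul, hφ, mul_apply_eq_comp, ← ContinuousLinearMap.adjoint_inner_left,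
        ← ContinuousLinearMap.star_eq_adjoint, hY ξ, real_inner_self_eq_norm_sq])
    hK
  have hn : ∀ Ω : Fin K → I, ‖∑ l, Y (Ω l)‖ = ‖∑ l, φ.symm (Y (Ω l))‖ := fun Ω => by
    rw [cstar_norm_def, map_sum]
    exact congrArg norm (Finset.sum_congr rfl fun l _ => (hφ (Ω l)).symm)
  simp only [hn]
  exact key

/-- Bernstein is applied to `Y ξ = N v_ξ v_ξᵀ - P` with `R = N C`. The frame identity makes them sum
to zero. They lie between `-1` and `N C`, and `hNC` makes this interval symmetric; the mean of their
squares is at most `N C` as well. -/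
theorem card_norm_starProjection_sub_ge_le (T : Submodule ℝ (EuclideanSpace ℝ ι))
    (v : I → EuclideanSpace ℝ ι) (hvT : ∀ ξ, v ξ ∈ T)
    (hframe : ∀ x, ∑ ξ, ⟪v ξ, x⟫ • v ξ = T.starProjection x) {C ε : ℝ}
    (hC : ∀ ξ, ‖v ξ‖ ^ 2 ≤ C) (hNC : 1 ≤ Fintype.card I * C)
    (hε0 : 0 < ε) (hε1 : ε ≤ 1) {K : ℕ} (hK : 0 < K) :
    (({Ω : Fin K → I | ε ≤ ‖T.starProjection - (K / Fintype.card I : ℝ)⁻¹ •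
        ∑ l, (innerSL ℝ (v (Ω l))).smulRight (v (Ω l))‖} : Finset _).card : ℝ)
      ≤ 2 * Fintype.card ι * (Fintype.card I : ℝ) ^ K *
        Real.exp (-(3 * K * ε ^ 2 / (8 * (Fintype.card I * C)))) := by
  set N : ℝ := (Fintype.card I : ℝ) with hN
  set P := T.starProjection with hP
  have hN0 : 0 < N := by
    rcases (Nat.cast_nonneg (Fintype.card I) : (0 : ℝ) ≤ _).eq_or_lt with h | h
    · rw [hN, ← h] at hNC; simp at hNC; linarith
    · exact h
  have hPv : ∀ ξ x, ⟪v ξ, P x⟫ = ⟪v ξ, x⟫ := fun ξ x => by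
    have := Submodule.starProjection_isSymmetric T (v ξ) x
    simp only [ContinuousLinearMap.coe_coe] at this
    rw [hP, ← this, Submodule.starProjection_eq_self_iff.2 (hvT ξ)]
  have hPn : ∀ x, ⟪x, P x⟫ = ‖P x‖ ^ 2 := fun x => by
    rw [← real_inner_self_eq_norm_sq, hP]
    have := Submodule.starProjection_isSymmetric T x (T.starProjection x)
    simp only [ContinuousLinearMap.coe_coe] at this
    rw [this, Submodule.starProjection_eq_self_iff.2 (Submodule.starProjection_apply_mem T x)]
  have hPle : ∀ x, ‖P x‖ ^ 2 ≤ ‖x‖ ^ 2 := fun x => by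
    have := T.norm_starProjection_apply_le x
    gcongr
  have hsum : ∀ x, ∑ ξ, ⟪v ξ, x⟫ ^ 2 = ‖P x‖ ^ 2 := fun x => by
    rw [← hPn, ← hframe, inner_sum]
    refine Finset.sum_congr rfl fun ξ _ => ?_
    rw [real_inner_smul_right, real_inner_comm, sq]
  have hcs : ∀ ξ x, ⟪v ξ, x⟫ ^ 2 ≤ C * ‖x‖ ^ 2 := fun ξ x => by
    have h1 := abs_real_inner_le_norm (v ξ) x
    calc ⟪v ξ, x⟫ ^ 2 = |⟪v ξ, x⟫| ^ 2 := (sq_abs _).symm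
      _ ≤ (‖v ξ‖ * ‖x‖) ^ 2 := by gcongr
      _ = ‖v ξ‖ ^ 2 * ‖x‖ ^ 2 := by ring
      _ ≤ C * ‖x‖ ^ 2 := by gcongr; exact hC ξ
  set Y : I → EuclideanSpace ℝ ι →L[ℝ] EuclideanSpace ℝ ι :=
    fun ξ => N • (innerSL ℝ (v ξ)).smulRight (v ξ) - P with hYdef
  have hYx : ∀ ξ x, Y ξ x = (N * ⟪v ξ, x⟫) • v ξ - P x := fun ξ x => by
    simp [hYdef, smul_smul]
  have hYq : ∀ ξ x, ⟪x, Y ξ x⟫ = N * ⟪v ξ, x⟫ ^ 2 - ‖P x‖ ^ 2 := fun ξ x => by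
    rw [hYx, inner_sub_right, real_inner_smul_right, real_inner_comm (v ξ) x, hPn]; ring
  have hKR : (0 : ℝ) < K := by exact_mod_cast hK
  have key := card_norm_sum_clm_ge_le Y ?_ ?_ (R := N * C) (by linarith) hε0 hε1 ?_ ?_ ?_ hK
  · have hiff : ∀ Ω : Fin K → I, ε ≤ ‖P - (K / N : ℝ)⁻¹ •
        ∑ l, (innerSL ℝ (v (Ω l))).smulRight (v (Ω l))‖ ↔ K * ε ≤ ‖∑ l, Y (Ω l)‖ := fun Ω => by
      have : P - (K / N : ℝ)⁻¹ • ∑ l, (innerSL ℝ (v (Ω l))).smulRight (v (Ω l))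
          = -((K : ℝ)⁻¹ • ∑ l, Y (Ω l)) := by
        simp only [hYdef, Finset.sum_sub_distrib, Finset.sum_const, Finset.card_univ,
          Fintype.card_fin, smul_sub, ← Finset.smul_sum, smul_smul, ← Nat.cast_smul_eq_nsmul ℝ]
        rw [inv_mul_cancel₀ hKR.ne', one_smul, neg_sub, inv_div, div_eq_inv_mul]
      rw [this, norm_neg, norm_smul, norm_inv, Real.norm_of_nonneg hKR.le, le_inv_mul_iff₀ hKR]
    simp only [hiff]
    exact key
  · intro ξ
    rw [ContinuousLinearMap.isSelfAdjoint_iff_isSymmetric]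
    intro x y
    have h := Submodule.starProjection_isSymmetric T x y
    simp only [ContinuousLinearMap.coe_coe] at h ⊢
    rw [hYx, hYx, inner_sub_left, inner_sub_right, h, real_inner_smul_left, real_inner_smul_right,
      real_inner_comm (v ξ) x]
    ring
  · ext1 x
    rw [_root_.sum_apply]
    simp only [hYx, Finset.sum_sub_distrib, mul_smul, ← Finset.smul_sum, hframe]
    simp [hN, ← Nat.cast_smul_eq_nsmul ℝ, hP]
  · intro ξ x
    rw [hYq]
    nlinarith [hcs ξ x, sq_nonneg ‖P x‖]
  · intro ξ x
    rw [hYq]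
    nlinarith [hPle x, sq_nonneg ⟪v ξ, x⟫, sq_nonneg ‖x‖,
      mul_nonneg hN0.le (sq_nonneg ⟪v ξ, x⟫)]
  · intro x
    have hterm : ∀ ξ, ‖Y ξ x‖ ^ 2 ≤ (N * (N * C) - 2 * N) * ⟪v ξ, x⟫ ^ 2 + ‖P x‖ ^ 2 := fun ξ => by
      rw [hYx, norm_sub_sq_real, norm_smul, real_inner_smul_left, hPv, mul_pow, Real.norm_eq_abs,
        sq_abs]
      nlinarith [mul_le_mul_of_nonneg_left (hC ξ) (sq_nonneg (N * ⟪v ξ, x⟫))]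
    calc ∑ ξ, ‖Y ξ x‖ ^ 2 ≤ ∑ ξ, ((N * (N * C) - 2 * N) * ⟪v ξ, x⟫ ^ 2 + ‖P x‖ ^ 2) :=
          Finset.sum_le_sum fun ξ _ => hterm ξ
      _ = N * (N * C) * ‖P x‖ ^ 2 - N * ‖P x‖ ^ 2 := by
          rw [Finset.sum_add_distrib, ← Finset.mul_sum, hsum, Finset.sum_const, Finset.card_univ,
            nsmul_eq_mul]
          ring
      _ ≤ N * (N * C) * ‖P x‖ ^ 2 := sub_le_self _ (by positivity)
      _ ≤ N * (N * C) * ‖x‖ ^ 2 := by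
          have : 0 ≤ N * (N * C) := by nlinarith
          gcongr ?_ * ?_
          exact hPle x

end FrameBernstein
-- From sample counts to the probability bound
namespace TensorTrain

section Sampling

variable {d : ℕ} {n m : Fin d → ℕ}

instance instIsProbabilityMeasureSampleLaw [Nonempty (Idx n)] (K : ℕ) :
    MeasureTheory.IsProbabilityMeasure (sampleLaw n K) := by
  unfold sampleLaw
  infer_instance

theorem sampleLaw_real_coe_finset (K : ℕ) (s : Finset (Fin K → Idx n)) :
    (sampleLaw n K).real s = s.card / (Fintype.card (Idx n) : ℝ) ^ K := by
  rw [sampleLaw, ← ProbabilityTheory.uniformOn_pi, Set.pi_univ, MeasureTheory.measureReal_def,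
    ProbabilityTheory.uniformOn_univ, MeasureTheory.Measure.count_apply_finset]
  simp

/-- The projected vector represents the functional that reads off entry `ξ` of `L P x`. Entrywise
bounds on `L` over `T` thus become norm bounds on these vectors. -/
theorem inner_starProjection_adjoint_single (L : Tensor m →L[ℝ] Tensor n)
    (T : Submodule ℝ (Tensor m)) (ξ : Idx n) (x : Tensor m) :
    inner ℝ (T.starProjection (ContinuousLinearMap.adjoint L (EuclideanSpace.single ξ 1))) x
      = L (T.starProjection x) ξ := by
  have := Submodule.starProjection_isSymmetric T
    (ContinuousLinearMap.adjoint L (EuclideanSpace.single ξ 1)) x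
  simp only [ContinuousLinearMap.coe_coe] at this
  rw [this, ContinuousLinearMap.adjoint_inner_left, EuclideanSpace.inner_single_left]
  simp

theorem starProjection_comp_samplingOperator_comp (L : Tensor m →L[ℝ] Tensor n)
    (T : Submodule ℝ (Tensor m)) {K : ℕ} (Ω : Fin K → Idx n) :
    T.starProjection ∘L ContinuousLinearMap.adjoint L ∘L samplingOperator Ω ∘L L
        ∘L T.starProjection
      = ∑ l, (innerSL ℝ (T.starProjection
          (ContinuousLinearMap.adjoint L (EuclideanSpace.single (Ω l) 1)))).smulRight
          (T.starProjection (ContinuousLinearMap.adjoint L (EuclideanSpace.single (Ω l) 1))) := by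
  ext1 x
  simp only [samplingOperator, ContinuousLinearMap.comp_apply, _root_.sum_apply, map_sum,
    ContinuousLinearMap.smulRight_apply, map_smul, innerSL_apply_apply,
    inner_starProjection_adjoint_single]
  rfl

theorem sum_inner_smul_starProjection_adjoint_single {L : Tensor m →L[ℝ] Tensor n}
    (hL : ContinuousLinearMap.adjoint L ∘L L = ContinuousLinearMap.id ℝ _)
    (T : Submodule ℝ (Tensor m)) (x : Tensor m) :
    ∑ ξ, inner ℝ (T.starProjection
        (ContinuousLinearMap.adjoint L (EuclideanSpace.single ξ 1))) x
        • T.starProjection (ContinuousLinearMap.adjoint L (EuclideanSpace.single ξ 1))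
      = T.starProjection x := by
  simp only [inner_starProjection_adjoint_single, ← map_smul, ← map_sum]
  have h1 : ∑ ξ, L (T.starProjection x) ξ • EuclideanSpace.single ξ (1 : ℝ)
      = L (T.starProjection x) := by
    simpa using (EuclideanSpace.basisFun (Idx n) ℝ).sum_repr (L (T.starProjection x))
  rw [h1]
  have h2 := DFunLike.congr_fun hL (T.starProjection x)
  simp only [ContinuousLinearMap.comp_apply, ContinuousLinearMap.id_apply] at h2
  rw [h2, Submodule.starProjection_eq_self_iff.2 (Submodule.starProjection_apply_mem T x)]

/-- For `d ≥ 2` there is an interior cut, where the TT-rank is a genuine matrix rank and not the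
conventional `1`. -/
theorem ne_zero_of_ttRank_pos {X : Tensor n} (hd : 2 ≤ d) (hr : ∀ k, 0 < ttRank X k) : X ≠ 0 := by
  rintro rfl
  have h := hr ⟨1, by omega⟩
  rw [ttRank_of_ne _ (by simp [Fin.ext_iff]) (by simp [Fin.ext_iff]; omega)] at h
  have h0 : ∀ k, unfolding k (0 : Tensor n) = 0 := fun k => by ext; simp [unfolding]
  rw [h0, Matrix.rank_zero] at h
  exact h.false

theorem pos_of_ne_zero {X : Tensor n} (hX : X ≠ 0) (k : Fin d) : 0 < n k := by
  by_contra h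
  refine hX (PiLp.ext fun i => ?_)
  exact absurd (i k).isLt (by omega)

theorem card_idx_le_pow (m : Fin d → ℕ) :
    (Fintype.card (Idx m) : ℝ) ≤ ((Finset.univ.sup m : ℕ) : ℝ) ^ d := by
  have : Fintype.card (Idx m) ≤ (Finset.univ.sup m) ^ d := by
    rw [Fintype.card_pi]
    refine (Finset.prod_le_pow_card _ _ (Finset.univ.sup m) fun k _ => ?_).trans (by simp)
    rw [Fintype.card_fin]
    exact Finset.le_sup (f := m) (Finset.mem_univ k)
  exact_mod_cast this

theorem sideConst_nonneg {r : Fin (d + 1) → ℕ} {μ₁ μ₂ : ℝ} (h₁ : 0 ≤ μ₁) (h₂ : 0 ≤ μ₂) :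
    0 ≤ sideConst n m r μ₁ μ₂ := by
  unfold sideConst
  positivity

/-- The tail bound for sampling an isometry `L` compressed to a subspace `T` on which the entries
of `L v` are at most `√C ‖v‖`. -/
theorem one_sub_le_sampleLaw_real {L : Tensor m →L[ℝ] Tensor n}
    (hL : ContinuousLinearMap.adjoint L ∘L L = ContinuousLinearMap.id ℝ _)
    (T : Submodule ℝ (Tensor m)) {C : ℝ} (hC0 : 0 ≤ C)
    (hC : ∀ v ∈ T, ∀ ξ, (L v ξ) ^ 2 ≤ C * ‖v‖ ^ 2) (hn : ∀ k, 0 < n k)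
    {M : ℝ} (hM : 1 < M) (hcard : Fintype.card (Idx m) ≤ M ^ d)
    {ε β : ℝ} (hε0 : 0 < ε) (hε1 : ε < 1) (hd : 0 < d) (hβ : 0 < β) {K : ℕ}
    (hρ : 8 / 3 * (C / ε ^ 2) * d * β * Real.log M ≤ density n K) :
    1 - 2 * M ^ ((d : ℝ) * (1 - β)) ≤ (sampleLaw n K).real {Ω : Fin K → Idx n |
        ‖T.starProjection - (density n K)⁻¹ • (T.starProjection ∘L ContinuousLinearMap.adjoint L
          ∘L samplingOperator Ω ∘L L ∘L T.starProjection)‖ < ε} := by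
  have hne : Nonempty (Idx n) := ⟨fun k => ⟨0, hn k⟩⟩
  have hM0 : 0 < M := one_pos.trans hM
  simp only [starProjection_comp_samplingOperator_comp]
  set v : Idx n → Tensor m := fun ξ =>
    T.starProjection (ContinuousLinearMap.adjoint L (EuclideanSpace.single ξ 1)) with hv
  have hvT : ∀ ξ, v ξ ∈ T := fun ξ => Submodule.starProjection_apply_mem T _
  have hvx : ∀ ξ x, inner ℝ (v ξ) x = L (T.starProjection x) ξ := fun ξ x =>
    inner_starProjection_adjoint_single L T ξ x
  have hframe : ∀ x, ∑ ξ, inner ℝ (v ξ) x • v ξ = T.starProjection x :=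
    sum_inner_smul_starProjection_adjoint_single hL T
  -- Entry `ξ` of `L (v ξ)` is `‖v ξ‖²`, so the hypothesis reads `‖v ξ‖⁴ ≤ C ‖v ξ‖²`.
  have hvC : ∀ ξ, ‖v ξ‖ ^ 2 ≤ C := fun ξ => by
    have h1 := hC (v ξ) (hvT ξ) ξ
    have h2 : L (v ξ) ξ = ‖v ξ‖ ^ 2 := by
      rw [← real_inner_self_eq_norm_sq, hvx, Submodule.starProjection_eq_self_iff.2 (hvT ξ)]
    rw [h2, sq (‖v ξ‖ ^ 2)] at h1
    rcases (sq_nonneg ‖v ξ‖).eq_or_lt with h | h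
    · rwa [← h]
    · exact le_of_mul_le_mul_right h1 h
  -- For `T = 0` the inequality `1 ≤ N C` may fail, but the deviation is then zero for every sample.
  by_cases hT : ∀ x ∈ T, x = 0
  · have hv0 : ∀ ξ, v ξ = 0 := fun ξ => hT _ (hvT ξ)
    have hP0 : T.starProjection = 0 := by
      ext1 x
      exact hT _ (Submodule.starProjection_apply_mem T x)
    have : {Ω : Fin K → Idx n | ‖T.starProjection - (density n K)⁻¹ •
        ∑ l, (innerSL ℝ (v (Ω l))).smulRight (v (Ω l))‖ < ε} = Set.univ := by
      ext Ω
      simp [hv0, hP0, hε0]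
    rw [this, MeasureTheory.probReal_univ]
    have := Real.rpow_pos_of_pos hM0 ((d : ℝ) * (1 - β))
    linarith
  push Not at hT
  obtain ⟨x, hxT, hx0⟩ := hT
  set N : ℝ := (Fintype.card (Idx n) : ℝ) with hN
  have hNC : 1 ≤ N * C := by
    have hPx : T.starProjection x = x := Submodule.starProjection_eq_self_iff.2 hxT
    have hx2 : 0 < ‖x‖ ^ 2 := by positivity
    refine le_of_mul_le_mul_right ?_ hx2
    calc 1 * ‖x‖ ^ 2 = inner ℝ x (T.starProjection x) := by
          rw [hPx, real_inner_self_eq_norm_sq, one_mul]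
      _ = ∑ ξ, (L x ξ) ^ 2 := by
          rw [← hframe, inner_sum]
          refine Finset.sum_congr rfl fun ξ _ => ?_
          rw [real_inner_smul_right, real_inner_comm (v ξ) x, hvx, hPx, sq]
      _ ≤ ∑ ξ : Idx n, C * ‖x‖ ^ 2 := Finset.sum_le_sum fun ξ _ => hC x hxT ξ
      _ = N * C * ‖x‖ ^ 2 := by
          rw [Finset.sum_const, Finset.card_univ, nsmul_eq_mul, mul_assoc]
  have hN0 : 0 < N := by
    rw [hN]
    exact_mod_cast Fintype.card_pos
  have hCpos : 0 < C := by
    by_contra h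
    have : N * C ≤ 0 := mul_nonpos_of_nonneg_of_nonpos hN0.le (not_lt.1 h)
    linarith
  have hdens : density n K = K / N := by
    rw [density, hN, Fintype.card_pi]
    simp
  rw [hdens] at hρ ⊢
  have hd' : (0 : ℝ) < d := by exact_mod_cast hd
  have hlog : 0 < Real.log M := Real.log_pos hM
  have hK : 0 < K := by
    have h1 : 0 < 8 / 3 * (C / ε ^ 2) * d * β * Real.log M := by positivity
    rcases Nat.eq_zero_or_pos K with h | h
    · rw [h, Nat.cast_zero, zero_div] at hρ
      linarith
    · exact h
  have key := card_norm_starProjection_sub_ge_le T v hvT hframe hvC hNC hε0 hε1.le hK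
  set bad : Finset (Fin K → Idx n) := {Ω : Fin K → Idx n | ε ≤ ‖T.starProjection - (K / N)⁻¹ •
        ∑ l, (innerSL ℝ (v (Ω l))).smulRight (v (Ω l))‖} with hbad
  have hgood : {Ω : Fin K → Idx n | ‖T.starProjection - (K / N)⁻¹ •
        ∑ l, (innerSL ℝ (v (Ω l))).smulRight (v (Ω l))‖ < ε} = (bad : Set (Fin K → Idx n))ᶜ := by
    ext Ω
    simp [hbad]
  rw [hgood, MeasureTheory.probReal_compl_eq_one_sub bad.measurableSet, sampleLaw_real_coe_finset]
  refine sub_le_sub_left ?_ 1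
  -- The constant `8/3` in the density condition cancels the `3/8` of the Bernstein exponent. The
  -- dimension factor `M ^ d` then leaves `M ^ (d (1 - β))`.
  have hexp : Real.exp (-(3 * K * ε ^ 2 / (8 * (N * C)))) ≤ M ^ (-(d * β)) := by
    rw [Real.rpow_def_of_pos hM0, Real.exp_le_exp]
    have h3 : d * β * Real.log M ≤ 3 * K * ε ^ 2 / (8 * (N * C)) := by
      calc d * β * Real.log M
          = 8 / 3 * (C / ε ^ 2) * d * β * Real.log M * (3 * ε ^ 2 / (8 * C)) := by
            field_simp
        _ ≤ K / N * (3 * ε ^ 2 / (8 * C)) := by gcongr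
        _ = 3 * K * ε ^ 2 / (8 * (N * C)) := by field_simp
    linarith
  rw [div_le_iff₀ (by positivity)]
  calc (bad.card : ℝ)
      ≤ 2 * Fintype.card (Idx m) * N ^ K * Real.exp (-(3 * K * ε ^ 2 / (8 * (N * C)))) := key
    _ ≤ 2 * M ^ d * N ^ K * M ^ (-(d * β)) := by gcongr
    _ = 2 * M ^ ((d : ℝ) * (1 - β)) * N ^ K := by
        rw [mul_sub, mul_one, sub_eq_add_neg, Real.rpow_add hM0, Real.rpow_natCast]
        ring

end Sampling

end TensorTrain

theorem mainTheorem3 {d : ℕ} (hd : 2 ≤ d) (n m : Fin d → ℕ) (r : Fin (d + 1) → ℕ)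
    (hr : ∀ k, 0 < r k)
    (Q : (k : Fin d) → Matrix (Fin (n k)) (Fin (m k)) ℝ)
    (hQ : ∀ k, (Q k).transpose * Q k = 1)
    (A : Tensor n) (B : Tensor m) (hAB : A = modeProduct Q B) (hA : A ∈ ttManifold n r)
    (μ₁ μ₂ : ℝ) (hμ₁ : coreCoherence A ≤ μ₁) (hμ₂ : ∀ k, coherence (Q k) ≤ μ₂)
    (ε : ℝ) (hε0 : 0 < ε) (hε1 : ε < 1) (β : ℝ) (hβ : 1 < β) (K : ℕ)
    (hρ : 8 / 3 * (sideConst n m r μ₁ μ₂ / ε ^ 2) * d * β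
      * Real.log ((Finset.univ.sup m : ℕ) : ℝ) ≤ density n K) :
    1 - 2 * ((Finset.univ.sup m : ℕ) : ℝ) ^ ((d : ℝ) * (1 - β)) ≤
      (sampleLaw n K).real {Ω : Fin K → Idx n |
        ‖(tangentSpaceAt (ttManifold m r) B).starProjection
          - (density n K)⁻¹ • ((tangentSpaceAt (ttManifold m r) B).starProjection
            ∘L ContinuousLinearMap.adjoint (modeProduct Q) ∘L samplingOperator Ω
            ∘L modeProduct Q ∘L (tangentSpaceAt (ttManifold m r) B).starProjection)‖ < ε} := by
  subst hAB
  have hA' : ttRank (modeProduct Q B) = r := hA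
  subst hA'
  have hA0 := ne_zero_of_ttRank_pos hd hr
  have hB0 : B ≠ 0 := by
    rintro rfl
    exact hA0 (map_zero _)
  have hn := pos_of_ne_zero hA0
  have hm := pos_of_ne_zero hB0
  have hm1 : 1 ≤ Finset.univ.sup m :=
    (hm ⟨0, by omega⟩).trans_le (Finset.le_sup (f := m) (Finset.mem_univ _))
  rcases hm1.eq_or_lt with h1 | h1
  -- If all `m_k = 1`, the claimed lower bound is `-1`.
  · rw [← h1, Nat.cast_one, Real.one_rpow]
    exact le_trans (by norm_num) MeasureTheory.measureReal_nonneg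
  · exact one_sub_le_sampleLaw_real (adjoint_modeProduct_comp hQ) _
      (sideConst_nonneg ((coreCoherence_nonneg _).trans hμ₁)
        ((coherence_nonneg _).trans (hμ₂ ⟨0, by omega⟩)))
      (fun v hv ξ => sq_modeProduct_apply_le hd hn hm hQ hr hμ₁ hμ₂ hv ξ)
      hn (by exact_mod_cast h1) (card_idx_le_pow m) hε0 hε1 (by omega) (by linarith) hρ
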